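/- Let $d\ge 1$ and let $\Psi=(\Psi(s))_{s\in\mathbb R^d}$ be a non-negative, jointly measurable random field on a probability space. A point process on $\mathbb R^d$ is a random simple counting measure that is finite on bounded sets; for an intensity $g\Psi$, with $g\ge 0$ measurable, $CP(g\Psi)$ denotes a point process which, conditionally on the random measure $\Lambda(ds)=\Psi(s)\,ds$, is a Poisson process with directing measure $g(s)\Psi(s)\,ds$ (it is part of this that almost surely $g\Psi$ is integrable over bounded sets). Let $f:\mathbb R^d\to[0,\infty)$ be measurable, let $N\sim CP(f\Psi)$ be almost surely finite, and let $M\sim CP((1-f)_+\Psi)$, with the same $\Psi$, be conditionally independent of $N$ given $\Lambda$. Put $$p=f^{-1}\mathbf 1_{\{f\ge 1\}}+\mathbf 1_{\{f<1\}},$$ and let $p\cdot N$ be the independent $p$-thinning of $N$: given $(N,\Lambda,M)$, each point $s$ of $N$ is kept, independently of the others, with probability $p(s)$ and deleted otherwise. Then: 1. $p$ is measurable and $p(s)\in[0,1]$ for all $s\in\mathbb R^d$; 2. almost surely $$p\cdot N+M=(p\cdot N)|_{\{f\ge 1\}}+N|_{\{f<1\}}+M|_{\{f<1\}},$$ where $(p\cdot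 N)|_{\{f\ge1\}}$ is an independent $p$-thinning of $N|_{\{f\ge 1\}}$ (given $(N,\Lambda,M)$), and $M|_{\{f<1\}}$ is, conditionally on $\Lambda$, a Poisson process with directing measure $\mathbf 1_{\{f<1\}}(s)(1-f(s))\Psi(s)\,ds$; 3. $p\cdot N+M\sim CP(\Psi)$, that is, conditionally on $\Lambda$ the superposition $p\cdot N+M$ is a Poisson process with directing measure $\Lambda$. -/

import Mathlib

open MeasureTheory ProbabilityTheory
open scoped ENNReal NNReal

noncomputable section

namespace CoxThinning

/-- A Borel measure is boundedly finite if bounded Borel sets have finite mass. -/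
def IsBoundedlyFinite {E : Type*} [MeasurableSpace E] [Bornology E] (μ : Measure E) : Prop :=
  ∀ B : Set E, MeasurableSet B → Bornology.IsBounded B → μ B < ∞

/-- Boundedly finite, integer-valued, and without multiple points. -/
structure IsSimpleCounting {E : Type*} [MeasurableSpace E] [Bornology E] (μ : Measure E) :
    Prop where
  natural : ∀ B : Set E, MeasurableSet B → Bornology.IsBounded B → ∃ n : ℕ, μ B = n
  simple : ∀ x : E, μ {x} ≤ 1

/-- A random measure. The σ-algebra on `Measure E` is the one generated by the evaluations
`μ ↦ μ B`, `B` Borel. -/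
structure IsRandomMeasure {Ω E : Type*} [MeasurableSpace Ω] [MeasurableSpace E] [Bornology E]
    (P : Measure Ω) (Λ : Ω → Measure E) : Prop where
  measurable : Measurable Λ
  boundedlyFinite : ∀ᵐ ω ∂P, IsBoundedlyFinite (Λ ω)

/-- A point process, that is, a random simple counting measure. -/
structure IsPointProcess {Ω E : Type*} [MeasurableSpace Ω] [MeasurableSpace E] [Bornology E]
    (P : Measure Ω) (N : Ω → Measure E) : Prop where
  measurable : Measurable N
  simpleCounting : ∀ᵐ ω ∂P, IsSimpleCounting (N ω)

/-- `Q`, a distribution on the space of measures, has the finite-dimensional distributions of the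
Poisson process with directing measure `μ`: the number of points in a Borel set of finite mass is
Poisson distributed, and the numbers of points in disjoint Borel sets are jointly independent. -/
structure IsPoissonLaw {E : Type*} [MeasurableSpace E] (μ : Measure E) (Q : Measure (Measure E)) :
    Prop where
  count : ∀ B : Set E, MeasurableSet B → μ B < ∞ →
    Q.map (fun φ => φ B) = (poissonMeasure (μ B).toNNReal).map (Nat.cast : ℕ → ℝ≥0∞)
  indep : ∀ (n : ℕ) (B : Fin n → Set E), (∀ i, MeasurableSet (B i)) →
    Pairwise (Function.onFun Disjoint B) → iIndepFun (fun i (φ : Measure E) => φ (B i)) Q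

/-- `N` is a point process which, conditionally on the random element `Z`, is a Poisson process
with directing measure `Λ`: some regular conditional distribution `κ` of `N` given `Z` is the law
of that Poisson process, for almost every value of `Z`. -/
structure IsCoxProcessGiven {Ω E S : Type*} [MeasurableSpace Ω] [MeasurableSpace E]
    [Bornology E] [MeasurableSpace S] (P : Measure Ω) (Z : Ω → S) (Λ : Ω → Measure E)
    (N : Ω → Measure E) : Prop where
  directing : IsRandomMeasure P Λ
  pointProcess : IsPointProcess P N
  poisson : ∃ κ : Kernel S (Measure E), IsMarkovKernel κ ∧ HasCondDistrib N Z κ P ∧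
    ∀ᵐ ω ∂P, IsPoissonLaw (Λ ω) (κ (Z ω))

/-- `N` is a Cox process directed by the random measure `Λ`: conditionally on `Λ`, it is a Poisson
process with directing measure `Λ`. -/
def IsCoxProcess {Ω E : Type*} [MeasurableSpace Ω] [MeasurableSpace E] [Bornology E]
    (P : Measure Ω) (Λ : Ω → Measure E) (N : Ω → Measure E) : Prop :=
  IsCoxProcessGiven P Λ Λ N

/-- Conditional independence of `X` and `Y` given (the σ-algebra generated by) `Z`. -/
def CondIndepGiven {Ω S A B : Type*} [MeasurableSpace Ω] [MeasurableSpace S] [MeasurableSpace A]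
    [MeasurableSpace B] (P : Measure Ω) (Z : Ω → S) (X : Ω → A) (Y : Ω → B) : Prop :=
  ∀ (a : Set A) (b : Set B), MeasurableSet a → MeasurableSet b →
    P⟦X ⁻¹' a ∩ Y ⁻¹' b | MeasurableSpace.comap Z inferInstance⟧ =ᵐ[P]
      fun ω => (P⟦X ⁻¹' a | MeasurableSpace.comap Z inferInstance⟧) ω *
        (P⟦Y ⁻¹' b | MeasurableSpace.comap Z inferInstance⟧) ω

/-- The distribution of the random measure obtained from the points `x 0, …, x (n - 1)` by keeping
each `x i`, independently of the others, with probability `p (x i)`: the set of indices kept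
is `s` with probability `∏_{i ∈ s} p (x i) * ∏_{i ∉ s} (1 - p (x i))`. -/
def thinLaw {E : Type*} [MeasurableSpace E] (p : E → ℝ) {n : ℕ} (x : Fin n → E) :
    Measure (Measure E) :=
  ∑ s : Finset (Fin n),
    ENNReal.ofReal ((∏ i ∈ s, p (x i)) * ∏ i ∈ sᶜ, (1 - p (x i))) •
      Measure.dirac (∑ i ∈ s, Measure.dirac (x i))

/-- `N'` is the independent `p`-thinning of the finite point process `N`, the deletions being
carried out independently of `W` as well: given `N` and `W`, with `N = ∑ i, δ_{x i}`, the point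
process `N'` arises by keeping each point `x i` independently with probability `p (x i)`. -/
structure IsThinningGiven {Ω E S : Type*} [MeasurableSpace Ω] [MeasurableSpace E] [Bornology E]
    [MeasurableSpace S] (P : Measure Ω) (W : Ω → S) (p : E → ℝ) (N N' : Ω → Measure E) :
    Prop where
  pointProcess : IsPointProcess P N'
  thinned : ∃ κ : Kernel (Measure E × S) (Measure E), IsMarkovKernel κ ∧
    HasCondDistrib N' (fun ω => (N ω, W ω)) κ P ∧
    ∀ᵐ z ∂(P.map (fun ω => (N ω, W ω))), ∃ (n : ℕ) (x : Fin n → E),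
      z.1 = ∑ i, Measure.dirac (x i) ∧ κ z = thinLaw p x

/-- The measure `g(s) ds` on `ℝ^d`. -/
def intensity {d : ℕ} (g : EuclideanSpace ℝ (Fin d) → ℝ) : Measure (EuclideanSpace ℝ (Fin d)) :=
  volume.withDensity (fun s => ENNReal.ofReal (g s))

/-- The retention function `p = f⁻¹ 1_{f ≥ 1} + 1_{f < 1}`. -/
def retention {E : Type*} (f : E → ℝ) (s : E) : ℝ :=
  (f s)⁻¹ * Set.indicator {t | 1 ≤ f t} 1 s + Set.indicator {t | f t < 1} 1 s

end CoxThinning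

end

noncomputable section

namespace CoxThinning

open Filter Topology BoundedContinuousFunction

/-! The heart is the pointwise identity `p f + (1 - f)_+ = 1` (`retention_mul_add_max`). Where `f ≥
1`, thinning cuts the intensity `f Ψ` down to `Ψ` and `M` has no points; where `f < 1`, nothing is
deleted and `M` supplies the missing `(1 - f) Ψ`.

The Poisson claim is proved conditionally on `Λ`, through Laplace functionals. A Poisson law
satisfies `E e^{-∫ g dφ} = exp (-∫ (1 - e^{-g}) dμ)` (`IsPoissonLaw.laplace`), and this formula
characterises it (`isPoissonLaw_of_laplace`), because the coordinate exponentials generate a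
point-separating algebra on `[0, ∞]^ι`. Thinning replaces `g` by the `h` with `e^{-h} = p e^{-g} + 1
- p`. Then `1 - e^{-h} = p (1 - e^{-g})`, so the intensity is multiplied by `p`, and independent
superposition adds intensities (`isPoissonLaw_thinning_add`).

Simplicity of the superposition is a separate matter. Double points could only lie in `{f < 1}`, and
conditionally independent Cox processes, one with diffuse directing measure, almost surely share no
point (`CondIndepGiven.ae_no_common_point`). -/

/-! ### The exponential on the extended half-line. -/

/-- The function `x ↦ e^{-x}` on `[0, ∞]`. -/
def expNeg (x : ℝ≥0∞) : ℝ≥0∞ := EReal.exp (-(x : EReal))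

@[simp] lemma expNeg_zero : expNeg 0 = 1 := by simp [expNeg]

lemma expNeg_add (x y : ℝ≥0∞) : expNeg (x + y) = expNeg x * expNeg y := by
  unfold expNeg
  rw [← EReal.exp_add, EReal.coe_ennreal_add, EReal.neg_add, sub_eq_add_neg]
  · exact Or.inl (EReal.coe_ennreal_ne_bot x)
  · exact Or.inr (EReal.coe_ennreal_ne_bot y)

lemma expNeg_sum {ι : Type*} (s : Finset ι) (x : ι → ℝ≥0∞) :
    expNeg (∑ i ∈ s, x i) = ∏ i ∈ s, expNeg (x i) := by
  classical
  induction s using Finset.induction_on with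
  | empty => simp
  | insert a s ha ih => rw [Finset.sum_insert ha, Finset.prod_insert ha, expNeg_add, ih]

lemma expNeg_natCast_mul (n : ℕ) (x : ℝ≥0∞) : expNeg (n * x) = expNeg x ^ n := by
  have := expNeg_sum (Finset.range n) (fun _ => x)
  simpa using this

lemma continuous_expNeg : Continuous expNeg :=
  ENNReal.continuous_exp.comp (continuous_neg.comp continuous_coe_ennreal_ereal)

@[fun_prop] lemma measurable_expNeg : Measurable expNeg := continuous_expNeg.measurable

lemma expNeg_strictAnti : StrictAnti expNeg := fun x y h =>
  EReal.exp_strictMono (by simpa [EReal.neg_lt_neg_iff] using h)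

lemma expNeg_le_one (x : ℝ≥0∞) : expNeg x ≤ 1 := by
  simpa using expNeg_strictAnti.antitone (zero_le : 0 ≤ x)

lemma expNeg_ne_top (x : ℝ≥0∞) : expNeg x ≠ ∞ := ((expNeg_le_one x).trans_lt ENNReal.one_lt_top).ne

lemma expNeg_ofReal {x : ℝ} (hx : 0 ≤ x) :
    expNeg (ENNReal.ofReal x) = ENNReal.ofReal (Real.exp (-x)) := by
  unfold expNeg
  rw [EReal.coe_ennreal_ofReal, max_eq_left hx, ← EReal.coe_neg, EReal.exp_coe]

/-- A measurable function with values in `[0, 1]` is of the form `e^{-g}` with `g` measurable. -/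
lemma exists_measurable_expNeg_comp {E : Type*} [MeasurableSpace E] {h : E → ℝ≥0∞}
    (hh : Measurable h) (h1 : ∀ x, h x ≤ 1) :
    ∃ g : E → ℝ≥0∞, Measurable g ∧ ∀ x, expNeg (g x) = h x := by
  -- Since `h ≤ 1`, `-log h` is nonnegative and `toENNReal` loses nothing; zeros of `h` give the
  -- value `∞`.
  refine ⟨fun x => (-(ENNReal.log (h x))).toENNReal, by fun_prop, fun x => ?_⟩
  unfold expNeg
  rw [EReal.coe_toENNReal, neg_neg, ENNReal.exp_log]
  rw [EReal.neg_nonneg]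
  simpa using ENNReal.log_monotone (h1 x)

/-! ### Laplace transforms determine finite measures. -/

section Uniqueness

variable {ι : Type*}

/-- The bounded continuous function `x ↦ e^{-x i}` on `[0, ∞]^ι`. -/
def expNegCoord (i : ι) : (ι → ℝ≥0∞) →ᵇ ℝ :=
  BoundedContinuousFunction.ofNormedAddCommGroup (fun x => (expNeg (x i)).toReal)
    (continuous_iff_continuousAt.2 fun x =>
      (ENNReal.continuousAt_toReal (expNeg_ne_top _)).comp
        (f := fun x : ι → ℝ≥0∞ => expNeg (x i))
        (continuous_expNeg.comp (continuous_apply i)).continuousAt) 1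
    (fun x => by
      rw [Real.norm_of_nonneg ENNReal.toReal_nonneg]
      exact ENNReal.toReal_le_of_le_ofReal zero_le_one (by simpa using expNeg_le_one _))

lemma expNegCoord_apply (i : ι) (x : ι → ℝ≥0∞) : expNegCoord i x = (expNeg (x i)).toReal := rfl

lemma exists_eq_prod_of_mem_closure_expNegCoord [Fintype ι] {g : (ι → ℝ≥0∞) →ᵇ ℝ}
    (hg : g ∈ Submonoid.closure (Set.range (expNegCoord (ι := ι)))) :
    ∃ k : ι → ℕ, g = ∏ i, expNegCoord i ^ k i := by
  classical
  induction hg using Submonoid.closure_induction with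
  | mem g hg =>
    obtain ⟨j, rfl⟩ := hg
    exact ⟨Pi.single j 1, by simp [Pi.single_apply, Finset.prod_ite_eq', pow_ite]⟩
  | one => exact ⟨0, by simp⟩
  | mul f g _ _ hf hg =>
    obtain ⟨k, rfl⟩ := hf
    obtain ⟨l, rfl⟩ := hg
    exact ⟨k + l, by simp [pow_add, Finset.prod_mul_distrib]⟩

/-- Finite measures on `[0, ∞]^ι` are determined by their Laplace transforms at integer points. -/
theorem ext_of_lintegral_prod_expNeg_pow [Fintype ι] {μ ν : Measure (ι → ℝ≥0∞)}
    [IsFiniteMeasure μ] [IsFiniteMeasure ν]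
    (h : ∀ k : ι → ℕ, ∫⁻ x, ∏ i, expNeg (x i) ^ k i ∂μ = ∫⁻ x, ∏ i, expNeg (x i) ^ k i ∂ν) :
    μ = ν := by
  let A : StarSubalgebra ℝ ((ι → ℝ≥0∞) →ᵇ ℝ) :=
    { Algebra.adjoin ℝ (Set.range (expNegCoord (ι := ι))) with
      star_mem' := fun {a} ha => by
        have : star a = a := by ext; simp
        rwa [this] }
  have hA : (A.map (toContinuousMapStarₐ ℝ)).SeparatesPoints := by
    intro x y hxy
    obtain ⟨i, hi⟩ := Function.ne_iff.1 hxy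
    refine ⟨expNegCoord i, ⟨toContinuousMapStarₐ ℝ (expNegCoord i), ⟨expNegCoord i,
      Algebra.subset_adjoin ⟨i, rfl⟩, rfl⟩, rfl⟩, ?_⟩
    rw [expNegCoord_apply, expNegCoord_apply]
    intro heq
    rw [ENNReal.toReal_eq_toReal_iff' (expNeg_ne_top _) (expNeg_ne_top _)] at heq
    exact hi (expNeg_strictAnti.injective heq)
  refine ext_of_forall_mem_subalgebra_integral_eq_of_polish hA fun g hg => ?_
  -- The algebra is the linear span of monomials in the coordinate exponentials, and the integral of
  -- a monomial is a Laplace transform at an integer point.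
  have hg' : g ∈ Submodule.span ℝ (Submonoid.closure (Set.range (expNegCoord (ι := ι))) : Set _) := by
    rw [← Algebra.adjoin_eq_span]; exact hg
  clear hg
  induction hg' using Submodule.span_induction with
  | mem g hg =>
    obtain ⟨k, rfl⟩ := exists_eq_prod_of_mem_closure_expNegCoord hg
    have key : ∀ ρ : Measure (ι → ℝ≥0∞), ∫ x, (∏ i, expNegCoord i ^ k i : (ι → ℝ≥0∞) →ᵇ ℝ) x ∂ρ
        = (∫⁻ x, ∏ i, expNeg (x i) ^ k i ∂ρ).toReal := by
      intro ρ
      rw [← integral_toReal (Measurable.aemeasurable (by fun_prop))]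
      · congr with x
        simp [BoundedContinuousFunction.coe_prod, expNegCoord_apply, ENNReal.toReal_prod]
      · refine ae_of_all _ fun x => ENNReal.prod_lt_top fun i _ => ?_
        exact ENNReal.pow_lt_top (expNeg_ne_top _).lt_top
    rw [key, key, h]
  | zero => simp
  | add f g _ _ hf hg =>
    simp only [BoundedContinuousFunction.coe_add, Pi.add_apply]
    rw [integral_add (f.integrable _) (g.integrable _),
      integral_add (f.integrable _) (g.integrable _), hf, hg]
  | smul c f _ hf =>
    simp only [BoundedContinuousFunction.coe_smul]
    rw [integral_smul, integral_smul, hf]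

end Uniqueness

/-! ### Laplace functional of the Poisson process. -/

section PoissonLaw

/-- Finite measures on `[0, ∞]` are determined by their Laplace transforms at the integers. -/
lemma ext_of_lintegral_expNeg_pow {μ ν : Measure ℝ≥0∞} [IsFiniteMeasure μ] [IsFiniteMeasure ν]
    (h : ∀ k : ℕ, ∫⁻ x, expNeg x ^ k ∂μ = ∫⁻ x, expNeg x ^ k ∂ν) : μ = ν := by
  have hc : Measurable (fun (x : ℝ≥0∞) (_ : Unit) => x) := by fun_prop
  have he : Measurable (fun (x : Unit → ℝ≥0∞) => x ()) := by fun_prop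
  have key : μ.map (fun x (_ : Unit) => x) = ν.map (fun x (_ : Unit) => x) := by
    refine ext_of_lintegral_prod_expNeg_pow fun k => ?_
    rw [lintegral_map (by fun_prop) hc, lintegral_map (by fun_prop) hc]
    simpa using h (k ())
  have := congrArg (Measure.map (fun x : Unit → ℝ≥0∞ => x ())) key
  rwa [Measure.map_map he hc, Measure.map_map he hc, show (fun x : Unit → ℝ≥0∞ => x ()) ∘
    (fun (x : ℝ≥0∞) (_ : Unit) => x) = id from rfl, Measure.map_id, Measure.map_id] at this

/-- The probability generating function of the Poisson distribution. -/
lemma lintegral_pow_poissonMeasure (r : ℝ≥0) {u : ℝ≥0∞} (hu : u ≤ 1) :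
    ∫⁻ n, u ^ n ∂(poissonMeasure r) = expNeg (r * (1 - u)) := by
  lift u to ℝ≥0 using (hu.trans_lt ENNReal.one_lt_top).ne
  have hu' : u ≤ 1 := by exact_mod_cast hu
  have hs := (NormedSpace.expSeries_div_hasSum_exp ((r : ℝ) * u)).mul_left (Real.exp (-r))
  rw [poissonMeasure, lintegral_sum_measure]
  simp_rw [lintegral_smul_measure, lintegral_dirac, smul_eq_mul]
  have h1 : ∀ n : ℕ, ENNReal.ofReal (Real.exp (-r) * r ^ n / n.factorial) * (u : ℝ≥0∞) ^ n =
      ENNReal.ofReal (Real.exp (-r) * (((r : ℝ) * u) ^ n / n.factorial)) := by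
    intro n
    rw [← ENNReal.ofReal_coe_nnreal, ← ENNReal.ofReal_pow (by positivity),
      ← ENNReal.ofReal_mul (by positivity)]
    congr 1
    ring
  simp_rw [h1]
  rw [← ENNReal.ofReal_tsum_of_nonneg (fun n => by positivity) hs.summable, hs.tsum_eq]
  have h2 : (r : ℝ≥0∞) * (1 - u) = ENNReal.ofReal (r * (1 - u)) := by
    rw [ENNReal.ofReal_mul (by positivity), ENNReal.ofReal_sub _ (by positivity)]
    simp
  rw [h2, expNeg_ofReal (mul_nonneg (by positivity) (sub_nonneg.2 (by exact_mod_cast hu'))),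
    ← Real.exp_eq_exp_ℝ, ← Real.exp_add]
  congr 2
  ring

variable {E : Type*} [MeasurableSpace E] {μ : Measure E} {Q : Measure (Measure E)}

@[fun_prop] lemma measurable_expNeg_lintegral {g : E → ℝ≥0∞} (hg : Measurable g) :
    Measurable (fun φ : Measure E => expNeg (∫⁻ x, g x ∂φ)) :=
  measurable_expNeg.comp (Measure.measurable_lintegral hg)

/-- The Poisson generating function at `u = e^{-y}`. -/
lemma IsPoissonLaw.lintegral_expNeg_mul (h : IsPoissonLaw μ Q) {B : Set E}
    (hB : MeasurableSet B) (hμB : μ B < ∞) (y : ℝ≥0∞) :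
    ∫⁻ φ, expNeg (y * φ B) ∂Q = expNeg ((1 - expNeg y) * μ B) := by
  calc ∫⁻ φ, expNeg (y * φ B) ∂Q = ∫⁻ z, expNeg (y * z) ∂(Q.map (fun φ => φ B)) := by
        rw [lintegral_map (by fun_prop) (Measure.measurable_coe hB)]
    _ = ∫⁻ n : ℕ, expNeg y ^ n ∂(poissonMeasure (μ B).toNNReal) := by
        rw [h.count B hB hμB, lintegral_map (by fun_prop) (by fun_prop)]
        simp_rw [mul_comm y, expNeg_natCast_mul]
    _ = _ := by
        rw [lintegral_pow_poissonMeasure _ (expNeg_le_one y), ENNReal.coe_toNNReal hμB.ne, mul_comm]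

/-- The integral is a finite sum over disjoint level sets, so independence factors its exponential.
The level set of `0` may have infinite mass, but its factor is `1` on both sides. -/
lemma IsPoissonLaw.laplace_simpleFunc (h : IsPoissonLaw μ Q) (g : SimpleFunc E ℝ≥0∞)
    (hg : ∀ y, y ≠ 0 → μ (g ⁻¹' {y}) < ∞) :
    ∫⁻ φ, expNeg (∫⁻ x, g x ∂φ) ∂Q = expNeg (∫⁻ x, (1 - expNeg (g x)) ∂μ) := by
  let e : Fin g.range.card ≃ g.range := g.range.equivFin.symm
  let B : Fin g.range.card → Set E := fun i => g ⁻¹' {(e i : ℝ≥0∞)}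
  have hsum : ∀ F : ℝ≥0∞ → ℝ≥0∞, ∑ y ∈ g.range, F y = ∑ i, F (e i) := by
    intro F
    rw [← Finset.sum_coe_sort, Equiv.sum_comp e (fun y : g.range => F y)]
  have hB : ∀ i, MeasurableSet (B i) := fun i => g.measurableSet_preimage _
  have hdisj : Pairwise (Function.onFun Disjoint B) := by
    intro i j hij
    refine Disjoint.preimage _ (Set.disjoint_singleton.2 fun hh => hij ?_)
    exact e.injective (Subtype.ext hh)
  have hind := (h.indep _ B hB hdisj).comp (fun i z => expNeg (e i * z)) (fun i => by fun_prop)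
  calc ∫⁻ φ, expNeg (∫⁻ x, g x ∂φ) ∂Q
      = ∫⁻ φ, ∏ i, expNeg (e i * φ (B i)) ∂Q := by
        congr with φ
        rw [SimpleFunc.lintegral_eq_lintegral, SimpleFunc.lintegral,
          hsum (fun y => y * φ (g ⁻¹' {y})), expNeg_sum]
    _ = ∏ i, ∫⁻ φ, expNeg (e i * φ (B i)) ∂Q :=
        lintegral_prod_eq_prod_lintegral_of_indepFun Finset.univ
          (fun i (φ : Measure E) => expNeg (e i * φ (B i))) hind
          (fun i => measurable_expNeg.comp ((Measure.measurable_coe (hB i)).const_mul _))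
    _ = ∏ i, expNeg ((1 - expNeg (e i)) * μ (B i)) := by
        refine Finset.prod_congr rfl fun i _ => ?_
        by_cases hi : (e i : ℝ≥0∞) = 0
        · have : IsProbabilityMeasure Q := hind.isProbabilityMeasure
          simp [hi]
        · exact h.lintegral_expNeg_mul (hB i) (hg _ hi) _
    _ = _ := by
        rw [← expNeg_sum, ← hsum (fun y => (1 - expNeg y) * μ (g ⁻¹' {y})),
          ← SimpleFunc.map_lintegral (fun y => 1 - expNeg y), ← SimpleFunc.lintegral_eq_lintegral]
        rfl

/-- The Laplace functional of the Poisson process. -/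
theorem IsPoissonLaw.laplace [SigmaFinite μ] [IsFiniteMeasure Q] (h : IsPoissonLaw μ Q)
    {g : E → ℝ≥0∞} (hg : Measurable g) :
    ∫⁻ φ, expNeg (∫⁻ x, g x ∂φ) ∂Q = expNeg (∫⁻ x, (1 - expNeg (g x)) ∂μ) := by
  -- Cutting down to the spanning sets gives the nonzero levels finite mass, as the simple case
  -- requires.
  let G : ℕ → SimpleFunc E ℝ≥0∞ := fun n => (SimpleFunc.eapprox g n).restrict (spanningSets μ n)
  have hG : ∀ n x, G n x = (spanningSets μ n).indicator (SimpleFunc.eapprox g n) x := fun n x =>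
    SimpleFunc.restrict_apply _ (measurableSet_spanningSets μ n) x
  have hmono : ∀ x, Monotone (fun n => G n x) := by
    intro x m n hmn
    simp only [hG]
    refine (Set.indicator_le_indicator_of_subset (monotone_spanningSets μ hmn)
      (fun _ => zero_le) x).trans (Set.indicator_le_indicator ?_)
    exact SimpleFunc.monotone_eapprox g hmn x
  have htend : ∀ x, Tendsto (fun n => G n x) atTop (𝓝 (g x)) := by
    intro x
    refine (SimpleFunc.tendsto_eapprox hg x).congr' ?_
    filter_upwards [eventually_ge_atTop (spanningSetsIndex μ x)] with n hn
    rw [hG, Set.indicator_of_mem]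
    exact monotone_spanningSets μ hn (mem_spanningSetsIndex μ x)
  have hfin : ∀ n y, y ≠ 0 → μ (G n ⁻¹' {y}) < ∞ := by
    intro n y hy
    refine (measure_mono fun x hx => ?_).trans_lt (measure_spanningSets_lt_top μ n)
    by_contra hxn
    refine hy ?_
    rw [← Set.mem_singleton_iff.1 hx, hG, Set.indicator_of_notMem hxn]
  have hleft : Tendsto (fun n => ∫⁻ φ, expNeg (∫⁻ x, G n x ∂φ) ∂Q) atTop
      (𝓝 (∫⁻ φ, expNeg (∫⁻ x, g x ∂φ) ∂Q)) := by
    refine tendsto_lintegral_of_dominated_convergence (fun _ => 1)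
      (fun n => measurable_expNeg_lintegral (G n).measurable)
      (fun n => ae_of_all _ fun φ => expNeg_le_one _) (by simp) (ae_of_all _ fun φ => ?_)
    refine (continuous_expNeg.tendsto _).comp ?_
    exact lintegral_tendsto_of_tendsto_of_monotone (fun n => (G n).measurable.aemeasurable)
      (ae_of_all _ hmono) (ae_of_all _ htend)
  have hright : Tendsto (fun n => expNeg (∫⁻ x, (1 - expNeg (G n x)) ∂μ)) atTop
      (𝓝 (expNeg (∫⁻ x, (1 - expNeg (g x)) ∂μ))) := by
    refine (continuous_expNeg.tendsto _).comp ?_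
    refine lintegral_tendsto_of_tendsto_of_monotone (fun n => ?_) (ae_of_all _ fun x m n hmn => ?_)
      (ae_of_all _ fun x => ?_)
    · exact (measurable_const.sub (measurable_expNeg.comp (G n).measurable)).aemeasurable
    · exact tsub_le_tsub_left (expNeg_strictAnti.antitone (hmono x hmn)) _
    · exact ENNReal.Tendsto.sub tendsto_const_nhds ((continuous_expNeg.tendsto _).comp (htend x))
        (Or.inl ENNReal.one_ne_top)
  refine tendsto_nhds_unique hleft (hright.congr fun n => ?_)
  exact (h.laplace_simpleFunc (G n) (hfin n)).symm

/-- Multiples `k 1_B` with integer `k` suffice as test functions, since Laplace transforms at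
integer points determine the law. -/
lemma lintegral_one_sub_expNeg_indicator {B : Set E} (hB : MeasurableSet B) (k : ℕ) :
    ∫⁻ x, (1 - expNeg (B.indicator (fun _ => (k : ℝ≥0∞)) x)) ∂μ = μ B * (1 - expNeg 1 ^ k) := by
  have : ∀ x, 1 - expNeg (B.indicator (fun _ => (k : ℝ≥0∞)) x) =
      B.indicator (fun _ => 1 - expNeg 1 ^ k) x := by
    intro x
    by_cases hx : x ∈ B
    · rw [Set.indicator_of_mem hx, Set.indicator_of_mem hx, ← expNeg_natCast_mul, mul_one]
    · simp [hx]
  simp_rw [this]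
  rw [lintegral_indicator_const hB, mul_comm]

/-- A law of random measures with the Laplace functional of a Poisson process is a Poisson law. -/
theorem isPoissonLaw_of_laplace [IsProbabilityMeasure Q]
    (h : ∀ g : E → ℝ≥0∞, Measurable g →
      ∫⁻ φ, expNeg (∫⁻ x, g x ∂φ) ∂Q = expNeg (∫⁻ x, (1 - expNeg (g x)) ∂μ)) :
    IsPoissonLaw μ Q := by
  -- Sets of infinite mass are included here, because the independence clause allows them.
  have hone : ∀ (B : Set E), MeasurableSet B → ∀ k : ℕ, ∫⁻ φ, expNeg (φ B) ^ k ∂Q =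
      expNeg (μ B * (1 - expNeg 1 ^ k)) := by
    intro B hB k
    rw [← lintegral_one_sub_expNeg_indicator hB, ← h _ (measurable_const.indicator hB)]
    congr with φ
    rw [lintegral_indicator_const hB, expNeg_natCast_mul]
  refine ⟨fun B hB hμB => ?_, fun n B hB hdisj => ?_⟩
  · have hm := Measure.measurable_coe hB
    have : IsProbabilityMeasure (Q.map fun φ => φ B) :=
      Measure.isProbabilityMeasure_map hm.aemeasurable
    refine ext_of_lintegral_expNeg_pow fun k => ?_
    rw [lintegral_map (by fun_prop) hm, hone B hB, lintegral_map (by fun_prop) (by fun_prop)]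
    have : ∀ n : ℕ, expNeg (n : ℝ≥0∞) ^ k = (expNeg 1 ^ k) ^ n := by
      intro n
      rw [← mul_one (n : ℝ≥0∞), expNeg_natCast_mul, ← pow_mul, ← pow_mul, mul_comm]
    simp_rw [this]
    rw [lintegral_pow_poissonMeasure _ (pow_le_one₀ zero_le (expNeg_le_one 1)),
      ENNReal.coe_toNNReal hμB.ne]
  · have hm : ∀ i, Measurable (fun φ : Measure E => φ (B i)) := fun i => Measure.measurable_coe (hB i)
    have hp : ∀ i, IsProbabilityMeasure (Q.map fun φ => φ (B i)) := fun i =>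
      Measure.isProbabilityMeasure_map (hm i).aemeasurable
    rw [iIndepFun_iff_map_fun_eq_pi_map fun i => (hm i).aemeasurable]
    have : IsProbabilityMeasure (Q.map fun φ i => φ (B i)) :=
      Measure.isProbabilityMeasure_map (measurable_pi_lambda _ hm).aemeasurable
    refine ext_of_lintegral_prod_expNeg_pow fun k => ?_
    rw [lintegral_map (by fun_prop) (measurable_pi_lambda _ hm)]
    have hpi : ∫⁻ x, ∏ i, expNeg (x i) ^ k i ∂(Measure.pi fun i => Q.map fun φ => φ (B i)) =
        ∏ i, ∫⁻ φ, expNeg (φ (B i)) ^ k i ∂Q := by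
      rw [lintegral_prod_eq_prod_lintegral_of_indepFun Finset.univ
        (fun i (x : Fin n → ℝ≥0∞) => expNeg (x i) ^ k i)
        (iIndepFun_pi (X := fun i (z : ℝ≥0∞) => expNeg z ^ k i)
          fun i => Measurable.aemeasurable (by fun_prop))
        (fun i => by fun_prop)]
      refine Finset.prod_congr rfl fun i _ => ?_
      rw [(measurePreserving_eval (fun i => Q.map fun φ => φ (B i)) i).lintegral_comp
        (f := fun z => expNeg z ^ k i) (by fun_prop), lintegral_map (by fun_prop) (hm i)]
    have hg : ∀ i, Measurable ((B i).indicator (fun _ => (k i : ℝ≥0∞))) := fun i =>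
      measurable_const.indicator (hB i)
    have hjoint := h (fun x => ∑ i, (B i).indicator (fun _ => (k i : ℝ≥0∞)) x) (by fun_prop)
    have hL : ∀ φ : Measure E, expNeg (∫⁻ x, ∑ i, (B i).indicator (fun _ => (k i : ℝ≥0∞)) x ∂φ) =
        ∏ i, expNeg (φ (B i)) ^ k i := by
      intro φ
      rw [lintegral_finsetSum _ fun i _ => hg i, expNeg_sum]
      refine Finset.prod_congr rfl fun i _ => ?_
      rw [lintegral_indicator_const (hB i), expNeg_natCast_mul]
    -- By disjointness at most one indicator is nonzero at `x`, so `1 - e^{-·}` is additive here.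
    -- This additivity turns into the factorisation.
    have hR : ∀ x, 1 - expNeg (∑ i, (B i).indicator (fun _ => (k i : ℝ≥0∞)) x) =
        ∑ i, (1 - expNeg ((B i).indicator (fun _ => (k i : ℝ≥0∞)) x)) := by
      intro x
      by_cases hx : ∃ j, x ∈ B j
      · obtain ⟨j, hj⟩ := hx
        have hne : ∀ i, i ≠ j → (B i).indicator (fun _ => (k i : ℝ≥0∞)) x = 0 := fun i hij =>
          Set.indicator_of_notMem (fun hi => Set.disjoint_left.1 (hdisj hij) hi hj) _
        rw [Finset.sum_eq_single j (fun i _ hij => hne i hij) (by simp),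
          Finset.sum_eq_single j (fun i _ hij => by simp [hne i hij]) (by simp)]
      · simp only [not_exists] at hx
        simp [hx]
    simp_rw [hL, hR] at hjoint
    rw [hjoint, hpi, lintegral_finsetSum _ fun i _ => by fun_prop, expNeg_sum]
    refine Finset.prod_congr rfl fun i _ => ?_
    rw [lintegral_one_sub_expNeg_indicator (hB i), hone _ (hB i)]

end PoissonLaw

/-! ### Independent thinning of finitely many points. -/

section Thinning

variable {E : Type*} [MeasurableSpace E]

@[fun_prop] lemma measurable_measure_add :
    Measurable (fun z : Measure E × Measure E => z.1 + z.2) := by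
  refine Measure.measurable_of_measurable_coe _ fun s hs => ?_
  simp only [Measure.coe_add, Pi.add_apply]
  exact ((Measure.measurable_coe hs).comp measurable_fst).add
    ((Measure.measurable_coe hs).comp measurable_snd)

@[fun_prop] lemma measurable_const_add_measure (ν : Measure E) :
    Measurable (fun φ : Measure E => ν + φ) :=
  measurable_measure_add.comp measurable_prodMk_left

lemma measurable_measure_restrict {A : Set E} (hA : MeasurableSet A) :
    Measurable (fun φ : Measure E => φ.restrict A) := by
  refine Measure.measurable_of_measurable_coe _ fun s hs => ?_
  simp only [Measure.restrict_apply hs]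
  exact Measure.measurable_coe (hs.inter hA)

lemma thinLaw_fin_zero (p : E → ℝ) (x : Fin 0 → E) : thinLaw p x = Measure.dirac 0 := by
  simp [thinLaw, Finset.univ_unique, Finset.eq_empty_of_isEmpty]

/-- The thinning of `n + 1` points arises from the thinning of the last `n` points by adding the
first point with its retention probability. -/
lemma thinLaw_fin_succ {p : E → ℝ} (hp : ∀ s, p s ∈ Set.Icc (0 : ℝ) 1) {n : ℕ}
    (x : Fin (n + 1) → E) :
    thinLaw p x = ENNReal.ofReal (p (x 0)) •
        (thinLaw p (fun i => x i.succ)).map (fun φ => Measure.dirac (x 0) + φ) +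
      ENNReal.ofReal (1 - p (x 0)) • thinLaw p (fun i => x i.succ) := by
  have hinj : Function.Injective (fun s : Finset (Fin n) => s.map (Fin.succEmb n)) :=
    Finset.map_injective _
  -- Sets of kept indices are split according to whether they contain `0`.
  have hsplit : ∀ F : Finset (Fin (n + 1)) → Measure (Measure E), ∑ s, F s =
      ∑ s : Finset (Fin n), F (insert 0 (s.map (Fin.succEmb n))) +
        ∑ s : Finset (Fin n), F (s.map (Fin.succEmb n)) := by
    intro F
    have h0 : (0 : Fin (n + 1)) ∉ (Finset.univ : Finset (Fin n)).map (Fin.succEmb n) := by simp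
    have hu : (Finset.univ : Finset (Fin (n + 1))) =
        insert 0 ((Finset.univ : Finset (Fin n)).map (Fin.succEmb n)) := by
      ext i; cases i using Fin.cases <;> simp
    have hpow : ((Finset.univ : Finset (Fin n)).map (Fin.succEmb n)).powerset =
        Finset.univ.map ⟨fun s : Finset (Fin n) => s.map (Fin.succEmb n), hinj⟩ := by
      ext s
      simp only [Finset.mem_powerset, Finset.subset_map_iff, Finset.mem_map, Finset.mem_univ,
        true_and, Function.Embedding.coeFn_mk, Finset.subset_univ]
      exact ⟨fun ⟨u, hu⟩ => ⟨u, hu.symm⟩, fun ⟨u, hu⟩ => ⟨u, hu.symm⟩⟩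
    rw [← Finset.powerset_univ, hu, Finset.sum_powerset_insert h0, hpow, Finset.sum_map,
      Finset.sum_map, add_comm]
    rfl
  have hc1 : ∀ s : Finset (Fin n), (insert 0 (s.map (Fin.succEmb n)))ᶜ = sᶜ.map (Fin.succEmb n) := by
    intro s; ext i; cases i using Fin.cases <;> simp
  have hc2 : ∀ s : Finset (Fin n), (s.map (Fin.succEmb n))ᶜ = insert 0 (sᶜ.map (Fin.succEmb n)) := by
    intro s; ext i; cases i using Fin.cases <;> simp
  have hn : ∀ s : Finset (Fin n), (0 : Fin (n + 1)) ∉ s.map (Fin.succEmb n) := by simp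
  rw [thinLaw, hsplit, thinLaw, Measure.map_finset_sum (by fun_prop), Finset.smul_sum, Finset.smul_sum]
  congr 1
  · refine Finset.sum_congr rfl fun s _ => ?_
    rw [hc1, Finset.prod_insert (hn s), Finset.sum_insert (hn s), Finset.prod_map, Finset.prod_map,
      Finset.sum_map, Measure.map_smul, Measure.map_dirac' (by fun_prop), smul_smul, mul_assoc,
      ENNReal.ofReal_mul (hp _).1]
    rfl
  · refine Finset.sum_congr rfl fun s _ => ?_
    rw [hc2, Finset.prod_insert (hn _), Finset.prod_map, Finset.prod_map,
      Finset.sum_map, smul_smul, mul_left_comm, ENNReal.ofReal_mul (sub_nonneg.2 (hp _).2)]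
    rfl

lemma ofReal_add_ofReal_one_sub {p : ℝ} (hp : p ∈ Set.Icc (0 : ℝ) 1) :
    ENNReal.ofReal p + ENNReal.ofReal (1 - p) = 1 := by
  rw [← ENNReal.ofReal_add hp.1 (sub_nonneg.2 hp.2)]
  simp

/-- The Laplace functional of an independent thinning. -/
lemma lintegral_expNeg_thinLaw {p : E → ℝ} (hp : ∀ s, p s ∈ Set.Icc (0 : ℝ) 1) {g h : E → ℝ≥0∞}
    (hg : Measurable g) (hh : Measurable h)
    (hgh : ∀ s, expNeg (h s) = ENNReal.ofReal (p s) * expNeg (g s) + ENNReal.ofReal (1 - p s))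
    {n : ℕ} (x : Fin n → E) :
    ∫⁻ φ, expNeg (∫⁻ s, g s ∂φ) ∂(thinLaw p x) =
      expNeg (∫⁻ s, h s ∂(∑ i, Measure.dirac (x i))) := by
  induction n with
  | zero => simp [thinLaw_fin_zero, lintegral_dirac' _ (measurable_expNeg_lintegral hg)]
  | succ n ih =>
    -- The first point contributes the factor `p e^{-g} + (1 - p) = e^{-h}`.
    rw [thinLaw_fin_succ hp, lintegral_add_measure, lintegral_smul_measure, lintegral_smul_measure,
      lintegral_map (by fun_prop) (by fun_prop), ih, Fin.sum_univ_succ]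
    simp only [lintegral_add_measure, expNeg_add, lintegral_dirac' _ hg, lintegral_dirac' _ hh, hgh]
    rw [lintegral_const_mul _ (by fun_prop), ih, smul_eq_mul, smul_eq_mul]
    ring

/-- The points in a region where the retention probability is `1` are all kept. -/
lemma ae_thinLaw_apply_eq {p : E → ℝ} (hp : ∀ s, p s ∈ Set.Icc (0 : ℝ) 1) {B : Set E}
    (hB : MeasurableSet B) (hpB : ∀ s ∈ B, p s = 1) {n : ℕ} (x : Fin n → E) :
    ∀ᵐ φ ∂(thinLaw p x), φ B = (∑ i, Measure.dirac (x i)) B := by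
  have hm : ∀ c, MeasurableSet {φ : Measure E | φ B = c} := fun c =>
    Measure.measurable_coe hB (measurableSet_singleton c)
  induction n with
  | zero => rw [thinLaw_fin_zero, ae_dirac_iff (hm _)]; simp
  | succ n ih =>
    rw [thinLaw_fin_succ hp, Fin.sum_univ_succ, ae_add_measure_iff]
    refine ⟨Measure.ae_smul_measure ?_ _, ?_⟩
    · rw [ae_map_iff (by fun_prop) (hm _)]
      filter_upwards [ih fun i => x i.succ] with φ hφ
      rw [Measure.add_apply, Measure.add_apply, hφ]
    · by_cases hx : x 0 ∈ B
      -- The branch deleting a point of `B` has weight `1 - p = 0`.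
      · simp [hpB _ hx]
      · refine Measure.ae_smul_measure ?_ _
        filter_upwards [ih fun i => x i.succ] with φ hφ
        rw [hφ, Measure.add_apply, Measure.dirac_apply' _ hB, Set.indicator_of_notMem hx, zero_add]

/-- The restriction of an independent thinning is an independent thinning of the restriction. -/
lemma exists_map_restrict_thinLaw {p : E → ℝ} (hp : ∀ s, p s ∈ Set.Icc (0 : ℝ) 1) {A : Set E}
    (hA : MeasurableSet A) {n : ℕ} (x : Fin n → E) :
    ∃ (m : ℕ) (y : Fin m → E),
      (∑ i, Measure.dirac (x i)).restrict A = ∑ i, Measure.dirac (y i) ∧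
      (thinLaw p x).map (fun φ => φ.restrict A) = thinLaw p y := by
  have hr := measurable_measure_restrict hA
  induction n with
  | zero => exact ⟨0, Fin.elim0, by simp, by simp [thinLaw_fin_zero, Measure.map_dirac' hr]⟩
  | succ n ih =>
    obtain ⟨m, y, hy1, hy2⟩ := ih fun i => x i.succ
    classical
    have hcomp : (fun φ : Measure E => φ.restrict A) ∘ (fun φ => Measure.dirac (x 0) + φ) =
        (fun φ => (if x 0 ∈ A then Measure.dirac (x 0) else 0) + φ) ∘ (fun φ => φ.restrict A) := by
      ext1 φ
      simp only [Function.comp_apply, Measure.restrict_add, restrict_dirac' hA]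
    rw [thinLaw_fin_succ hp, Fin.sum_univ_succ, Measure.restrict_add, hy1, restrict_dirac' hA,
      Measure.map_add _ _ hr, Measure.map_smul, Measure.map_smul, Measure.map_map hr (by fun_prop),
      hcomp, ← Measure.map_map (by fun_prop) hr, hy2]
    by_cases hx : x 0 ∈ A
    · refine ⟨m + 1, Fin.cons (x 0) y, by simp [hx, Fin.sum_univ_succ], ?_⟩
      rw [thinLaw_fin_succ hp]
      simp [hx]
    -- A point outside `A` is invisible after restriction, so keeping and deleting it give the same
    -- law, with weights summing to `1`.
    · refine ⟨m, y, by simp [hx], ?_⟩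
      simp only [hx, if_false, zero_add]
      rw [show (fun φ : Measure E => φ) = id from rfl, Measure.map_id, ← add_smul,
        ofReal_add_ofReal_one_sub (hp _), one_smul]

end Thinning

/-! ### Conditional distributions and conditional independence. -/

section Conditional

variable {Ω S A B : Type*} [MeasurableSpace Ω] [MeasurableSpace S] [MeasurableSpace A]
  [MeasurableSpace B] {P : Measure Ω} [IsProbabilityMeasure P] {Z : Ω → S} {X : Ω → A} {Y : Ω → B}
  {κ : Kernel S A} [IsMarkovKernel κ] {η : Kernel S B} [IsMarkovKernel η]

lemma measure_inter_eq_setLIntegral_of_hasCondDistrib (hZ : Measurable Z)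
    (h : HasCondDistrib X Z κ P) {c : Set S} (hc : MeasurableSet c) {a : Set A}
    (ha : MeasurableSet a) :
    P (Z ⁻¹' c ∩ X ⁻¹' a) = ∫⁻ ω in Z ⁻¹' c, κ (Z ω) a ∂P := by
  have h1 := congrArg (fun ν => ν (c ×ˢ a)) h.map_eq
  beta_reduce at h1
  rw [Measure.map_apply_of_aemeasurable h.aemeasurable (hc.prod ha),
    Measure.compProd_apply_prod hc ha, setLIntegral_map hc (κ.measurable_coe ha) hZ] at h1
  exact h1

/-- The bridge between `CondIndepGiven`, phrased with conditional expectations, and the kernels used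
for Poisson laws. -/
lemma condExp_indicator_of_hasCondDistrib (hZ : Measurable Z) (hX : Measurable X)
    (h : HasCondDistrib X Z κ P) {a : Set A} (ha : MeasurableSet a) :
    P⟦X ⁻¹' a | MeasurableSpace.comap Z inferInstance⟧ =ᵐ[P] fun ω => (κ (Z ω) a).toReal := by
  have hκ : Measurable (fun ω => κ (Z ω) a) := (κ.measurable_coe ha).comp hZ
  have hint : Integrable (fun ω => (κ (Z ω) a).toReal) P := by
    refine integrable_toReal_of_lintegral_ne_top hκ.aemeasurable ?_
    refine ((lintegral_mono fun ω => (prob_le_one : κ (Z ω) a ≤ 1)).trans_lt ?_).ne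
    simp
  refine (ae_eq_condExp_of_forall_setIntegral_eq hZ.comap_le
    ((integrable_const _).indicator (hX ha)) (fun _ _ _ => hint.integrableOn) ?_ ?_).symm
  · rintro _ ⟨c, hc, rfl⟩ -
    rw [integral_toReal hκ.aemeasurable (ae_of_all _ fun ω => measure_lt_top _ _),
      ← measure_inter_eq_setLIntegral_of_hasCondDistrib hZ h hc ha, setIntegral_indicator (hX ha)]
    simp [Measure.real]
  · exact (((κ.measurable_coe ha).comp (comap_measurable Z)).ennreal_toReal).aestronglyMeasurable

/-- Conditionally independent random elements have the product of their conditional distributions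
as joint conditional distribution. -/
theorem CondIndepGiven.hasCondDistrib_prod (hXY : CondIndepGiven P Z X Y) (hZ : Measurable Z)
    (hXm : Measurable X) (hYm : Measurable Y) (hX : HasCondDistrib X Z κ P)
    (hY : HasCondDistrib Y Z η P) :
    HasCondDistrib (fun ω => (X ω, Y ω)) Z (κ ×ₖ η) P := by
  refine ⟨by fun_prop, ?_⟩
  have : IsProbabilityMeasure (P.map fun ω => (Z ω, X ω, Y ω)) :=
    Measure.isProbabilityMeasure_map (by fun_prop)
  -- Measurable boxes determine the joint law; on a box, the claim is the conditional product
  -- formula integrated over `Z ⁻¹' c`.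
  refine Measure.ext_prod₃ fun {c a b} hc ha hb => ?_
  have hm : Measurable (fun ω => κ (Z ω) a * η (Z ω) b) :=
    ((κ.measurable_coe ha).comp hZ).mul ((η.measurable_coe hb).comp hZ)
  have hle : ∀ ω, κ (Z ω) a * η (Z ω) b ≤ 1 := fun ω => mul_le_one' prob_le_one prob_le_one
  have hcond := hXY a b ha hb
  have hprod : P⟦X ⁻¹' a ∩ Y ⁻¹' b | MeasurableSpace.comap Z inferInstance⟧ =ᵐ[P]
      fun ω => (κ (Z ω) a * η (Z ω) b).toReal := by
    filter_upwards [hcond, condExp_indicator_of_hasCondDistrib hZ hXm hX ha,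
      condExp_indicator_of_hasCondDistrib hZ hYm hY hb] with ω h1 h2 h3
    rw [h1, h2, h3, ENNReal.toReal_mul]
  have hset := setIntegral_condExp (μ := P) hZ.comap_le (s := Z ⁻¹' c)
    (f := (X ⁻¹' a ∩ Y ⁻¹' b).indicator fun _ => (1 : ℝ))
    ((integrable_const _).indicator ((hXm ha).inter (hYm hb))) ⟨c, hc, rfl⟩
  rw [setIntegral_congr_ae (hZ hc) (hprod.mono fun ω h _ => h),
    setIntegral_indicator ((hXm ha).inter (hYm hb)), integral_toReal hm.aemeasurable
      (ae_of_all _ fun ω => (hle ω).trans_lt ENNReal.one_lt_top)] at hset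
  simp only [integral_const, smul_eq_mul, mul_one, Measure.real] at hset
  rw [ENNReal.toReal_eq_toReal_iff' _ (measure_ne_top _ _)] at hset
  · rw [Measure.map_apply (by fun_prop) (hc.prod (ha.prod hb)),
      Measure.compProd_apply_prod hc (ha.prod hb)]
    simp_rw [Kernel.prod_apply_prod]
    rw [setLIntegral_map hc (f := fun z => κ z a * η z b)
      ((κ.measurable_coe ha).mul (η.measurable_coe hb)) hZ, hset, Measure.restrict_apply_univ]
    rfl
  · refine ((lintegral_mono hle).trans_lt ?_).ne
    simp

/-- A property which holds conditionally almost surely holds almost surely. -/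
lemma ae_of_ae_ae_hasCondDistrib (hZ : Measurable Z) (h : HasCondDistrib X Z κ P)
    {D : Set (S × A)} (hD : MeasurableSet D)
    (hae : ∀ᵐ ω ∂P, ∀ᵐ x ∂(κ (Z ω)), (Z ω, x) ∈ D) : ∀ᵐ ω ∂P, (Z ω, X ω) ∈ D := by
  refine ae_of_ae_map h.aemeasurable (p := fun z => z ∈ D) ?_
  rw [h.map_eq, Measure.ae_compProd_iff (p := fun z => z ∈ D) hD, ae_map_iff hZ.aemeasurable]
  · exact hae
  · exact (Kernel.measurable_kernel_prodMk_left hD.compl) (measurableSet_singleton 0)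

/-- The conditional distributions charge only what is almost surely true. -/
lemma ae_ae_of_ae_hasCondDistrib (hZ : Measurable Z) (h : HasCondDistrib X Z κ P)
    {p : S × A → Prop} (hae : ∀ᵐ z ∂(P.map fun ω => (Z ω, X ω)), p z) :
    ∀ᵐ ω ∂P, ∀ᵐ x ∂(κ (Z ω)), p (Z ω, x) := by
  rw [h.map_eq] at hae
  exact ae_of_ae_map hZ.aemeasurable (Measure.ae_ae_of_ae_compProd hae)

end Conditional

/-- Two-step conditioning: the joint conditional distribution of `X` and `V` given `Z`. -/
lemma hasCondDistrib_prodMk_compProd {Ω S A C : Type*} [MeasurableSpace Ω] [MeasurableSpace S]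
    [MeasurableSpace A] [MeasurableSpace C] {P : Measure Ω} {Z : Ω → S} {X : Ω → A} {V : Ω → C}
    {κ : Kernel S A} {K : Kernel (S × A) C} [IsMarkovKernel K] (hX : HasCondDistrib X Z κ P)
    (hV : HasCondDistrib V (fun ω => (Z ω, X ω)) K P) :
    HasCondDistrib (fun ω => (X ω, V ω)) Z (κ ⊗ₖ K) P := by
  have h1 := hX.aemeasurable
  have h2 := hV.aemeasurable_snd
  refine ⟨?_, ?_⟩
  · exact (h1.fst.prodMk (h1.snd.prodMk h2))
  · rw [← Measure.compProd_assoc', ← hX.map_eq, ← hV.map_eq,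
      AEMeasurable.map_map_of_aemeasurable (by fun_prop) hV.aemeasurable]
    rfl

/-! ### Countable determining classes. -/

/-- A countable family of Borel sets that determines finite measures. -/
lemma exists_countable_determining (E : Type*) [MeasurableSpace E]
    [MeasurableSpace.CountablyGenerated E] :
    ∃ 𝒞 : Set (Set E), 𝒞.Countable ∧ (∀ C ∈ 𝒞, MeasurableSet C) ∧
      ∀ μ ν : Measure E, IsFiniteMeasure μ → (∀ C ∈ 𝒞, μ C = ν C) → μ = ν := by
  -- The algebra generated by a countable family is again countable, and is a π-system containing
  -- the whole space.
  have hcount := countable_generateSetAlgebra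
    (MeasurableSpace.countable_countableGeneratingSet (α := E))
  have halg := isSetAlgebra_generateSetAlgebra (𝒜 := MeasurableSpace.countableGeneratingSet E)
  have hgen := (generateFrom_generateSetAlgebra_eq
    (𝒜 := MeasurableSpace.countableGeneratingSet E)).trans
      MeasurableSpace.generateFrom_countableGeneratingSet
  refine ⟨_, hcount, fun C hC => ?_, fun μ ν _ h => ?_⟩
  · rw [← hgen]; exact MeasurableSpace.measurableSet_generateFrom hC
  · exact ext_of_generate_finite _ hgen.symm (fun s hs t ht _ => halg.inter_mem hs ht) h
      (h _ halg.univ_mem)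

/-! ### Absence of common points of independent Poisson processes. -/

section Atoms

variable {E : Type*} [MeasurableSpace E] {μ ν : Measure E} {Q R : Measure (Measure E)}

/-- A Poisson variable of mean `λ` is nonzero with probability `1 - e^{-λ} ≤ λ`. -/
lemma IsPoissonLaw.measure_ne_zero_le [IsProbabilityMeasure Q] (h : IsPoissonLaw μ Q) {B : Set E}
    (hB : MeasurableSet B) (hμB : μ B < ∞) : Q {φ | φ B ≠ 0} ≤ μ B := by
  have hm := Measure.measurable_coe hB
  have h0 : MeasurableSet {φ : Measure E | φ B = 0} := hm (measurableSet_singleton 0)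
  have h1 : Q {φ | φ B = 0} = ENNReal.ofReal (Real.exp (-(μ B).toReal)) := by
    have := congrArg (fun ρ => ρ {0}) (h.count B hB hμB)
    beta_reduce at this
    rw [Measure.map_apply hm (measurableSet_singleton 0),
      Measure.map_apply (by fun_prop) (measurableSet_singleton 0),
      show (Nat.cast : ℕ → ℝ≥0∞) ⁻¹' {0} = {0} by ext; simp, poissonMeasure_singleton] at this
    rwa [ENNReal.coe_toNNReal_eq_toReal, pow_zero, mul_one, Nat.factorial_zero,
      Nat.cast_one, div_one] at this
  have h2 : {φ : Measure E | φ B ≠ 0} = {φ | φ B = 0}ᶜ := rfl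
  rw [h2, prob_compl_eq_one_sub h0, h1, tsub_le_iff_right, ← ENNReal.ofReal_one]
  nth_rewrite 1 [← ENNReal.ofReal_toReal hμB.ne]
  rw [← ENNReal.ofReal_add ENNReal.toReal_nonneg (Real.exp_nonneg _)]
  refine ENNReal.ofReal_le_ofReal ?_
  linarith [Real.add_one_le_exp (-(μ B).toReal)]

/-- Pairs of measures both of which charge, for every `n`, some common set of the `n`-th partition
of `B` given by the injection `b` into the Cantor space. -/
def commonCell (b : E → ℕ → Bool) (B : Set E) : Set (Measure E × Measure E) :=
  ⋂ n : ℕ, ⋃ w : Fin n → Bool, {z | z.1 ({x | ∀ i : Fin n, b x i = w i} ∩ B) ≠ 0 ∧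
    z.2 ({x | ∀ i : Fin n, b x i = w i} ∩ B) ≠ 0}

lemma measurableSet_cell {b : E → ℕ → Bool} (hb : Measurable b) {n : ℕ} (w : Fin n → Bool) :
    MeasurableSet {x | ∀ i : Fin n, b x i = w i} := by
  have : {x | ∀ i : Fin n, b x i = w i} = ⋂ i : Fin n, (fun x => b x i) ⁻¹' {w i} := by
    ext; simp
  rw [this]
  exact MeasurableSet.iInter fun i => ((measurable_pi_apply _).comp hb) (measurableSet_singleton _)

lemma measurableSet_commonCell {b : E → ℕ → Bool} (hb : Measurable b) {B : Set E}
    (hB : MeasurableSet B) : MeasurableSet (commonCell b B) := by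
  refine MeasurableSet.iInter fun n => MeasurableSet.iUnion fun w => ?_
  have hm := Measure.measurable_coe ((measurableSet_cell hb w).inter hB)
  have h0 : MeasurableSet {φ : Measure E | φ ({x | ∀ i : Fin n, b x i = w i} ∩ B) ≠ 0} :=
    hm (measurableSet_singleton 0).compl
  exact (measurable_fst h0).inter (measurable_snd h0)

/-- The cell given by the first `n` bits of `b x` contains `x`. Thus `commonCell` is a measurable
event covering the uncountable union, over points of `B`, of the events of a common atom. -/
lemma mem_commonCell_of_ne_zero (b : E → ℕ → Bool) {B : Set E} {x : E} (hx : x ∈ B)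
    {z : Measure E × Measure E} (h1 : z.1 {x} ≠ 0) (h2 : z.2 {x} ≠ 0) : z ∈ commonCell b B := by
  refine Set.mem_iInter.2 fun n => Set.mem_iUnion.2 ⟨fun i => b x i, ?_, ?_⟩
  · exact fun h => h1 (measure_mono_null (by simp [hx]) h)
  · exact fun h => h2 (measure_mono_null (by simp [hx]) h)

/-- Independent Poisson processes, one of them diffuse, have no common points. -/
lemma measure_prod_commonCell [IsProbabilityMeasure Q] [IsProbabilityMeasure R]
    [NullSingletonClass μ] (hQ : IsPoissonLaw μ Q) (hR : IsPoissonLaw ν R) {b : E → ℕ → Bool}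
    (hb : Measurable b) (hinj : Function.Injective b) {B : Set E} (hB : MeasurableSet B)
    (hμ : μ B < ∞) (hν : ν B < ∞) : (Q.prod R) (commonCell b B) = 0 := by
  have : IsFiniteMeasure (μ.restrict B) := ⟨by simpa using hμ⟩
  have : IsFiniteMeasure (ν.restrict B) := ⟨by simpa using hν⟩
  let cell : ∀ n, (Fin n → Bool) → Set E := fun n w => {x | ∀ i : Fin n, b x i = w i}
  have hcell : ∀ n w, MeasurableSet (cell n w) := fun n w => measurableSet_cell hb w
  -- Pairs agreeing in the first `n` bits; since `b` is injective, these sets decrease to the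
  -- diagonal.
  let D : ℕ → Set (E × E) := fun n => ⋃ w : Fin n → Bool, cell n w ×ˢ cell n w
  have hD : ∀ n, MeasurableSet (D n) := fun n =>
    MeasurableSet.iUnion fun w => (hcell n w).prod (hcell n w)
  have hDmem : ∀ n z, z ∈ D n ↔ ∀ i < n, b z.1 i = b z.2 i := by
    intro n z
    simp only [D, cell, Set.mem_iUnion, Set.mem_prod, Set.mem_ofPred_eq]
    refine ⟨fun ⟨w, h1, h2⟩ i hi => ?_, fun h => ⟨fun i => b z.1 i, fun i => rfl, fun i => ?_⟩⟩
    · rw [h1 ⟨i, hi⟩, h2 ⟨i, hi⟩]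
    · exact (h i i.2).symm
  -- Union bound over the cells: by independence each costs at most `μ(cell ∩ B) ν(cell ∩ B)`, and
  -- these products add up to the mass of `D n`.
  have hbound : ∀ n, (Q.prod R) (commonCell b B) ≤ ((μ.restrict B).prod (ν.restrict B)) (D n) := by
    intro n
    calc (Q.prod R) (commonCell b B)
        ≤ (Q.prod R) (⋃ w : Fin n → Bool,
            {φ : Measure E | φ (cell n w ∩ B) ≠ 0} ×ˢ {φ : Measure E | φ (cell n w ∩ B) ≠ 0}) :=
          measure_mono (Set.iInter_subset _ n)
      _ ≤ ∑ w : Fin n → Bool, (Q.prod R) ({φ : Measure E | φ (cell n w ∩ B) ≠ 0} ×ˢ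
            {φ : Measure E | φ (cell n w ∩ B) ≠ 0}) := measure_iUnion_fintype_le _ _
      _ ≤ ∑ w : Fin n → Bool, μ (cell n w ∩ B) * ν (cell n w ∩ B) := by
          refine Finset.sum_le_sum fun w _ => ?_
          rw [Measure.prod_prod]
          have hm := (hcell n w).inter hB
          gcongr
          · exact hQ.measure_ne_zero_le hm ((measure_mono Set.inter_subset_right).trans_lt hμ)
          · exact hR.measure_ne_zero_le hm ((measure_mono Set.inter_subset_right).trans_lt hν)
      _ = ∑ w : Fin n → Bool, ((μ.restrict B).prod (ν.restrict B)) (cell n w ×ˢ cell n w) := by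
          simp_rw [Measure.prod_prod, Measure.restrict_apply (hcell n _)]
      _ = _ := by
          rw [measure_iUnion _ fun w => (hcell n w).prod (hcell n w), tsum_fintype]
          intro w v hwv
          refine Set.disjoint_left.2 fun z hz hz' => hwv (funext fun i => ?_)
          rw [← hz.1 i, ← hz'.1 i]
  have hlim : Filter.Tendsto (fun n => ((μ.restrict B).prod (ν.restrict B)) (D n)) Filter.atTop
      (nhds (((μ.restrict B).prod (ν.restrict B)) (⋂ n, D n))) := by
    refine tendsto_measure_iInter_atTop (fun n => (hD n).nullMeasurableSet) ?_
      ⟨0, measure_ne_top _ _⟩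
    intro m n hmn z hz
    rw [hDmem] at hz ⊢
    exact fun i hi => hz i (hi.trans_le hmn)
  -- Sections in the first variable have at most one point, so diffuseness of `μ` alone suffices.
  have hdiag : ((μ.restrict B).prod (ν.restrict B)) (⋂ n, D n) = 0 := by
    rw [Measure.prod_apply_symm (MeasurableSet.iInter hD)]
    refine (lintegral_congr fun y => ?_).trans lintegral_zero
    have hsub : (fun x => (x, y)) ⁻¹' (⋂ n, D n) ⊆ {y} := by
      intro x hx
      refine hinj (funext fun i => ?_)
      exact (hDmem (i + 1) _).1 (Set.mem_iInter.1 hx (i + 1)) i i.lt_succ_self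
    exact measure_mono_null hsub (Measure.restrict_apply_le _ _ |>.trans_eq
      (measure_singleton y) |> le_zero_iff.1)
  rw [hdiag] at hlim
  exact le_antisymm (ge_of_tendsto' hlim hbound) zero_le

end Atoms

/-! ### Thinning plus superposition, for deterministic intensities. -/

section Superposition

variable {E : Type*} [MeasurableSpace E]

/-- The superposition of an independent thinning of a Poisson process and an independent Poisson
process is a Poisson process. -/
theorem isPoissonLaw_thinning_add {μ₁ μ₂ μ : Measure E} [SigmaFinite μ₁] [SigmaFinite μ₂]
    {Q R : Measure (Measure E)} [IsProbabilityMeasure Q] [IsProbabilityMeasure R]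
    (hQ : IsPoissonLaw μ₁ Q) (hR : IsPoissonLaw μ₂ R) {p : E → ℝ} (hpm : Measurable p)
    (hp : ∀ s, p s ∈ Set.Icc (0 : ℝ) 1) {K : Kernel (Measure E × Measure E) (Measure E)}
    [IsMarkovKernel K]
    (hK : ∀ᵐ z ∂(Q.prod R), ∃ (n : ℕ) (x : Fin n → E),
      z.1 = ∑ i, Measure.dirac (x i) ∧ K z = thinLaw p x)
    (hμ : ∀ h : E → ℝ≥0∞, Measurable h →
      ∫⁻ s, ENNReal.ofReal (p s) * h s ∂μ₁ + ∫⁻ s, h s ∂μ₂ = ∫⁻ s, h s ∂μ) :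
    IsPoissonLaw μ (((Q.prod R) ⊗ₘ K).map (fun z => z.2 + z.1.2)) := by
  have hadd : Measurable (fun z : (Measure E × Measure E) × Measure E => z.2 + z.1.2) :=
    measurable_measure_add.comp (by fun_prop : Measurable fun z : (Measure E × Measure E) ×
      Measure E => (z.2, z.1.2))
  have : IsProbabilityMeasure (((Q.prod R) ⊗ₘ K).map (fun z => z.2 + z.1.2)) :=
    Measure.isProbabilityMeasure_map hadd.aemeasurable
  refine isPoissonLaw_of_laplace fun g hg => ?_
  have hle : ∀ s, ENNReal.ofReal (p s) * expNeg (g s) + ENNReal.ofReal (1 - p s) ≤ 1 := by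
    intro s
    calc _ ≤ ENNReal.ofReal (p s) * 1 + ENNReal.ofReal (1 - p s) := by
          gcongr; exact expNeg_le_one _
      _ = 1 := by rw [mul_one, ofReal_add_ofReal_one_sub (hp s)]
  obtain ⟨h, hh, hgh⟩ := exists_measurable_expNeg_comp
    (h := fun s => ENNReal.ofReal (p s) * expNeg (g s) + ENNReal.ofReal (1 - p s))
    (by fun_prop) hle
  -- This is where thinning becomes multiplication of the intensity by `p`.
  have hsub : ∀ s, 1 - expNeg (h s) = ENNReal.ofReal (p s) * (1 - expNeg (g s)) := by
    intro s
    have hfin : ENNReal.ofReal (p s) * expNeg (g s) + ENNReal.ofReal (1 - p s) ≠ ∞ :=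
      ((hle s).trans_lt ENNReal.one_lt_top).ne
    rw [hgh]
    refine ENNReal.sub_eq_of_eq_add hfin ?_
    rw [← add_assoc, ← mul_add, tsub_add_cancel_of_le (expNeg_le_one _), mul_one,
      ofReal_add_ofReal_one_sub (hp s)]
  have hmeas := measurable_expNeg_lintegral hg
  calc ∫⁻ φ, expNeg (∫⁻ s, g s ∂φ) ∂(((Q.prod R) ⊗ₘ K).map (fun z => z.2 + z.1.2))
      = ∫⁻ z, ∫⁻ φ, expNeg (∫⁻ s, g s ∂φ) * expNeg (∫⁻ s, g s ∂z.2) ∂(K z) ∂(Q.prod R) := by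
        rw [lintegral_map hmeas hadd,
          Measure.lintegral_compProd (f := fun z : (Measure E × Measure E) × Measure E =>
              expNeg (∫⁻ s, g s ∂(z.2 + z.1.2)))
            (hmeas.comp hadd)]
        simp_rw [lintegral_add_measure, expNeg_add]
    _ = ∫⁻ z, expNeg (∫⁻ s, h s ∂z.1) * expNeg (∫⁻ s, g s ∂z.2) ∂(Q.prod R) := by
        refine lintegral_congr_ae ?_
        filter_upwards [hK] with z ⟨n, x, hx, hz⟩
        rw [lintegral_mul_const _ hmeas, hz, lintegral_expNeg_thinLaw hp hg hh hgh, hx]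
    _ = expNeg (∫⁻ s, (1 - expNeg (h s)) ∂μ₁) * expNeg (∫⁻ s, (1 - expNeg (g s)) ∂μ₂) := by
        rw [lintegral_prod_mul (measurable_expNeg_lintegral hh).aemeasurable hmeas.aemeasurable,
          hQ.laplace hh, hR.laplace hg]
    _ = expNeg (∫⁻ s, (1 - expNeg (g s)) ∂μ) := by
        rw [← expNeg_add, ← hμ _ (by fun_prop)]
        simp_rw [hsub]

/-- Counts of the restricted process in `C` are counts of the original one in `C ∩ B`. -/
lemma IsPoissonLaw.restrict {μ : Measure E} {Q : Measure (Measure E)} (h : IsPoissonLaw μ Q)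
    {B : Set E} (hB : MeasurableSet B) :
    IsPoissonLaw (μ.restrict B) (Q.map fun φ => φ.restrict B) := by
  have hr := measurable_measure_restrict hB
  refine ⟨fun C hC hμC => ?_, fun n C hC hdisj => ?_⟩
  · rw [Measure.restrict_apply hC] at hμC ⊢
    rw [Measure.map_map (Measure.measurable_coe hC) hr, ← h.count _ (hC.inter hB) hμC]
    congr 1
    ext1 φ
    exact Measure.restrict_apply hC
  · have hind := h.indep n (fun i => C i ∩ B) (fun i => (hC i).inter hB)
      (fun i j hij => (hdisj hij).mono Set.inter_subset_left Set.inter_subset_left)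
    rw [iIndepFun_iff_measure_inter_preimage_eq_mul] at hind ⊢
    intro T sets hsets
    have hpre : ∀ i, (fun φ : Measure E => φ.restrict B) ⁻¹' ((fun φ : Measure E => φ (C i)) ⁻¹'
        sets i) = (fun φ : Measure E => φ (C i ∩ B)) ⁻¹' sets i := fun i => by
      ext φ
      simp [Measure.restrict_apply (hC i)]
    have hms : ∀ i ∈ T, MeasurableSet ((fun φ : Measure E => φ (C i)) ⁻¹' sets i) := fun i hi =>
      Measure.measurable_coe (hC i) (hsets i hi)
    rw [Measure.map_apply hr (Finset.measurableSet_biInter T hms), Set.preimage_iInter₂]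
    simp_rw [hpre]
    rw [hind T hsets]
    refine Finset.prod_congr rfl fun i hi => ?_
    rw [Measure.map_apply hr (hms i hi), hpre]

end Superposition

/-! ### Restricting Cox processes and thinnings to a set. -/

section Restriction

variable {Ω E S : Type*} [MeasurableSpace Ω] [MeasurableSpace E] [Bornology E] [MeasurableSpace S]
  {P : Measure Ω} {Z : Ω → S} {Λ N N' : Ω → Measure E} {p : E → ℝ} {B : Set E}

lemma IsSimpleCounting.restrict {μ : Measure E} (h : IsSimpleCounting μ) (hB : MeasurableSet B) :
    IsSimpleCounting (μ.restrict B) where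
  natural C hC hCb := by
    rw [Measure.restrict_apply hC]
    exact h.natural _ (hC.inter hB) (hCb.subset Set.inter_subset_left)
  simple x := (Measure.restrict_apply_le _ _).trans (h.simple x)

lemma IsPointProcess.restrict (h : IsPointProcess P N) (hB : MeasurableSet B) :
    IsPointProcess P (fun ω => (N ω).restrict B) where
  measurable := (measurable_measure_restrict hB).comp h.measurable
  simpleCounting := h.simpleCounting.mono fun _ hω => hω.restrict hB

lemma IsRandomMeasure.restrict (h : IsRandomMeasure P Λ) (hB : MeasurableSet B) :
    IsRandomMeasure P (fun ω => (Λ ω).restrict B) where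
  measurable := (measurable_measure_restrict hB).comp h.measurable
  boundedlyFinite := h.boundedlyFinite.mono fun _ hω C hC hCb =>
    (Measure.restrict_apply_le _ _).trans_lt (hω C hC hCb)

variable [IsProbabilityMeasure P]

lemma IsCoxProcessGiven.restrict (hcox : IsCoxProcessGiven P Z Λ N) (hB : MeasurableSet B) :
    IsCoxProcessGiven P Z (fun ω => (Λ ω).restrict B) (fun ω => (N ω).restrict B) where
  directing := hcox.directing.restrict hB
  pointProcess := hcox.pointProcess.restrict hB
  poisson := by
    obtain ⟨κ, hκ, hcond, hpoi⟩ := hcox.poisson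
    have hr := measurable_measure_restrict hB
    refine ⟨κ.map fun φ => φ.restrict B, Kernel.IsMarkovKernel.map κ hr, hcond.comp_left hr, ?_⟩
    filter_upwards [hpoi] with ω hω
    rw [Kernel.map_apply _ hr]
    exact hω.restrict hB

/-- A Cox process has no points where its directing measure vanishes. -/
lemma IsCoxProcessGiven.ae_apply_eq_zero (h : IsCoxProcessGiven P Z Λ N) (hZ : Measurable Z)
    (hB : MeasurableSet B) (hΛ : ∀ᵐ ω ∂P, Λ ω B = 0) : ∀ᵐ ω ∂P, N ω B = 0 := by
  obtain ⟨κ, hκ, hcond, hpoi⟩ := h.poisson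
  have hD : MeasurableSet {φ : Measure E | φ B = 0} :=
    Measure.measurable_coe hB (measurableSet_singleton 0)
  refine ae_of_ae_ae_hasCondDistrib hZ hcond (D := Prod.snd ⁻¹' {φ | φ B = 0})
    (measurable_snd hD) ?_
  filter_upwards [hpoi, hΛ] with ω h1 h2
  have := h1.measure_ne_zero_le hB (h2 ▸ ENNReal.zero_lt_top)
  rw [h2] at this
  exact le_zero_iff.1 this

/-- A thinning does not change the process where the retention probability is `1`. -/
lemma IsThinningGiven.ae_restrict_eq [MeasurableSpace.CountablyGenerated E] {W : Ω → S}
    (h : IsThinningGiven P W p N N') (hW : Measurable W) (hN : Measurable N)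
    (hfin : ∀ᵐ ω ∂P, N ω Set.univ < ∞) (hp : ∀ s, p s ∈ Set.Icc (0 : ℝ) 1)
    (hB : MeasurableSet B) (hpB : ∀ s ∈ B, p s = 1) :
    ∀ᵐ ω ∂P, (N' ω).restrict B = (N ω).restrict B := by
  obtain ⟨κ, hκ, hcond, hthin⟩ := h.thinned
  obtain ⟨𝒞, hcount, hmeas, hdet⟩ := exists_countable_determining E
  have hNW : Measurable (fun ω => (N ω, W ω)) := hN.prodMk hW
  -- Each set has its own exceptional null event; a countable determining class allows a common one.
  have key : ∀ C ∈ 𝒞, ∀ᵐ ω ∂P, N' ω (C ∩ B) = N ω (C ∩ B) := by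
    intro C hC
    have hm := (hmeas C hC).inter hB
    refine ae_of_ae_ae_hasCondDistrib hNW hcond
      (D := {z | z.2 (C ∩ B) = z.1.1 (C ∩ B)}) ?_ ?_
    · exact measurableSet_eq_fun ((Measure.measurable_coe hm).comp measurable_snd)
        ((Measure.measurable_coe hm).comp (measurable_fst.comp measurable_fst))
    · filter_upwards [ae_of_ae_map hNW.aemeasurable hthin] with ω ⟨n, x, hx, hκx⟩
      rw [hκx]
      filter_upwards [ae_thinLaw_apply_eq hp hm (fun s hs => hpB s hs.2) x] with φ hφ
      exact hφ.trans (by rw [← hx])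
  have key' := (ae_ball_iff hcount).2 key
  filter_upwards [key', hfin] with ω h1 h2
  have : IsFiniteMeasure (N ω) := ⟨h2⟩
  refine (hdet _ _ inferInstance fun C hC => ?_).symm
  rw [Measure.restrict_apply (hmeas C hC), Measure.restrict_apply (hmeas C hC), h1 C hC]

/-- The restriction of a thinning is a thinning of the restriction. -/
lemma IsThinningGiven.restrict [MeasurableSpace.CountablyGenerated E] {W : Ω → S}
    (hthinned : IsThinningGiven P W p N N') (hW : Measurable W) (hN : Measurable N)
    (hfin : ∀ᵐ ω ∂P, N ω Set.univ < ∞) (hp : ∀ s, p s ∈ Set.Icc (0 : ℝ) 1)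
    (hB : MeasurableSet B) :
    IsThinningGiven P (fun ω => (N ω, W ω)) p (fun ω => (N ω).restrict B)
      (fun ω => (N' ω).restrict B) where
  pointProcess := hthinned.pointProcess.restrict hB
  thinned := by
    obtain ⟨κ, hκ, hcond, hthin⟩ := hthinned.thinned
    obtain ⟨𝒞, hcount, hmeas, hdet⟩ := exists_countable_determining E
    have hr := measurable_measure_restrict hB
    have hNW : Measurable (fun ω => (N ω, W ω)) := hN.prodMk hW
    have hF : Measurable (fun w : Measure E × S => (w.1.restrict B, w)) :=
      (hr.comp measurable_fst).prodMk measurable_id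
    -- The added coordinate `N.restrict B` is a function of `N`, so the kernel may ignore it.
    let K : Kernel (Measure E × Measure E × S) (Measure E) := κ.comap Prod.snd measurable_snd
    have : IsMarkovKernel K := Kernel.IsMarkovKernel.comap κ measurable_snd
    have hcond' : HasCondDistrib N' ((fun w : Measure E × S => (w.1.restrict B, w)) ∘
        fun ω => (N ω, W ω)) K P := by
      refine HasCondDistrib.comp_right (hf := hF) ?_
      rw [← Kernel.comap_comp_right]
      exact hcond
    refine ⟨K.map fun φ => φ.restrict B,
      Kernel.IsMarkovKernel.map _ hr, hcond'.comp_left hr, ?_⟩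
    have hg : Measurable (fun ω => ((N ω).restrict B, (N ω, W ω))) := hF.comp hNW
    have hthin' : ∀ᵐ z ∂(P.map fun ω => ((N ω).restrict B, (N ω, W ω))),
        ∃ (n : ℕ) (x : Fin n → E), z.2.1 = ∑ i, Measure.dirac (x i) ∧ κ z.2 = thinLaw p x := by
      refine ae_of_ae_map measurable_snd.aemeasurable
        (p := fun w => ∃ (n : ℕ) (x : Fin n → E),
          w.1 = ∑ i, Measure.dirac (x i) ∧ κ w = thinLaw p x) ?_
      rw [Measure.map_map measurable_snd hg]
      exact hthin
    -- Encodes `z.1 = z.2.1.restrict B` by countably many equalities, which makes the event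
    -- measurable, as `ae_map_iff` requires.
    have hrestr : ∀ᵐ z ∂(P.map fun ω => ((N ω).restrict B, (N ω, W ω))),
        z.1 Set.univ < ∞ ∧ ∀ C ∈ 𝒞, z.1 C = z.2.1 (C ∩ B) := by
      rw [ae_map_iff hg.aemeasurable]
      · filter_upwards [hfin] with ω hω
        exact ⟨(Measure.restrict_apply_le _ _).trans_lt hω, fun C hC =>
          Measure.restrict_apply (hmeas C hC)⟩
      · have hall : MeasurableSet
            {z : Measure E × (Measure E × S) | ∀ C ∈ 𝒞, z.1 C = z.2.1 (C ∩ B)} := by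
          have : {z : Measure E × (Measure E × S) | ∀ C ∈ 𝒞, z.1 C = z.2.1 (C ∩ B)} =
              ⋂ C ∈ 𝒞, {z | z.1 C = z.2.1 (C ∩ B)} := by ext; simp
          rw [this]
          refine MeasurableSet.biInter hcount fun C hC => measurableSet_eq_fun
            ((Measure.measurable_coe (hmeas C hC)).comp measurable_fst) ?_
          exact (Measure.measurable_coe ((hmeas C hC).inter hB)).comp
            (measurable_fst.comp measurable_snd)
        exact MeasurableSet.inter
          (((Measure.measurable_coe MeasurableSet.univ).comp measurable_fst) measurableSet_Iio) hall
    filter_upwards [hthin', hrestr] with z ⟨n, x, hx, hκx⟩ ⟨hz, hz'⟩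
    obtain ⟨m, y, hy, hy'⟩ := exists_map_restrict_thinLaw hp hB x
    refine ⟨m, y, ?_, ?_⟩
    · rw [← hy, ← hx]
      refine hdet _ _ ⟨hz⟩ fun C hC => ?_
      rw [Measure.restrict_apply (hmeas C hC), hz' C hC]
    · rw [Kernel.map_apply _ hr, Kernel.comap_apply, hκx, hy']

end Restriction

/-! ### Superposition of conditionally independent Cox processes. -/

section Superposition

variable {Ω E S : Type*} [MeasurableSpace Ω] [MeasurableSpace E] [MeasurableSpace S]
  {P : Measure Ω} [IsProbabilityMeasure P] {Z : Ω → S} {Λ Λ₁ Λ₂ N N' M : Ω → Measure E}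
  {p : E → ℝ}

/-- Conditionally independent Cox processes, one of them with diffuse directing measure, have no
common points. -/
lemma CondIndepGiven.ae_no_common_point [SeminormedAddCommGroup E] [OpensMeasurableSpace E]
    [MeasurableSpace.CountablySeparated E] (hZ : Measurable Z)
    (hN : IsCoxProcessGiven P Z Λ₁ N) (hM : IsCoxProcessGiven P Z Λ₂ M)
    (hNM : CondIndepGiven P Z N M) (hΛ₁ : ∀ ω, NullSingletonClass (Λ₁ ω)) :
    ∀ᵐ ω ∂P, ∀ x, N ω {x} = 0 ∨ M ω {x} = 0 := by
  obtain ⟨κ, hκ, hNκ, hNpoi⟩ := hN.poisson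
  obtain ⟨η, hη, hMη, hMpoi⟩ := hM.poisson
  have hjoint := hNM.hasCondDistrib_prod hZ hN.pointProcess.measurable hM.pointProcess.measurable
    hNκ hMη
  obtain ⟨b, hb, hinj⟩ := MeasurableSpace.measurable_injection_nat_bool_of_countablySeparated E
  have hball : ∀ n : ℕ, MeasurableSet (Metric.ball (0 : E) n) := fun n =>
    Metric.isOpen_ball.measurableSet
  -- The directing measures are finite only on bounded sets, hence the exhaustion by balls.
  have key : ∀ n : ℕ, ∀ᵐ ω ∂P, (N ω, M ω) ∈ (commonCell b (Metric.ball (0 : E) n))ᶜ := by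
    intro n
    have hC := measurableSet_commonCell hb (hball n)
    refine ae_of_ae_ae_hasCondDistrib hZ hjoint
      (D := Prod.snd ⁻¹' (commonCell b (Metric.ball (0 : E) n))ᶜ) (measurable_snd hC.compl) ?_
    filter_upwards [hNpoi, hMpoi, hN.directing.boundedlyFinite, hM.directing.boundedlyFinite]
      with ω h1 h2 h3 h4
    rw [Kernel.prod_apply]
    have := hΛ₁ ω
    refine measure_mono_null (fun z hz => ?_) (measure_prod_commonCell h1 h2 hb hinj (hball n)
      (h3 _ (hball n) Metric.isBounded_ball) (h4 _ (hball n) Metric.isBounded_ball))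
    by_contra hz'
    exact hz hz'
  filter_upwards [ae_all_iff.2 key] with ω hω x
  by_contra! hx
  obtain ⟨n, hn⟩ := exists_nat_gt ‖x‖
  exact hω n (mem_commonCell_of_ne_zero b (by simpa using hn) hx.1 hx.2)

/-- The superposition of an independent thinning of a Cox process and a conditionally independent
Cox process is conditionally Poisson. -/
lemma exists_poisson_kernel_thinning_add [Bornology E] (hZ : Measurable Z)
    (hN : IsCoxProcessGiven P Z Λ₁ N) (hM : IsCoxProcessGiven P Z Λ₂ M)
    (hNM : CondIndepGiven P Z N M) (hN' : IsThinningGiven P (fun ω => (Z ω, M ω)) p N N')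
    (hΛ₁ : ∀ ω, SigmaFinite (Λ₁ ω)) (hΛ₂ : ∀ ω, SigmaFinite (Λ₂ ω))
    (hpm : Measurable p) (hp : ∀ s, p s ∈ Set.Icc (0 : ℝ) 1)
    (hΛ : ∀ ω, ∀ h : E → ℝ≥0∞, Measurable h →
      ∫⁻ s, ENNReal.ofReal (p s) * h s ∂(Λ₁ ω) + ∫⁻ s, h s ∂(Λ₂ ω) = ∫⁻ s, h s ∂(Λ ω)) :
    ∃ κ : Kernel S (Measure E), IsMarkovKernel κ ∧
      HasCondDistrib (fun ω => N' ω + M ω) Z κ P ∧ ∀ᵐ ω ∂P, IsPoissonLaw (Λ ω) (κ (Z ω)) := by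
  obtain ⟨κ, hκ, hNκ, hNpoi⟩ := hN.poisson
  obtain ⟨η, hη, hMη, hMpoi⟩ := hM.poisson
  obtain ⟨τ, hτ, hN'τ, hthin⟩ := hN'.thinned
  have hNm := hN.pointProcess.measurable
  have hMm := hM.pointProcess.measurable
  have hjoint := hNM.hasCondDistrib_prod hZ hNm hMm hNκ hMη
  have hg : Measurable (fun z : S × (Measure E × Measure E) => (z.2.1, (z.1, z.2.2))) := by fun_prop
  have hf : Measurable (fun z : Measure E × (S × Measure E) => (z.2.1, (z.1, z.2.2))) := by fun_prop
  have hZNM : Measurable (fun ω => (Z ω, (N ω, M ω))) := hZ.prodMk (hNm.prodMk hMm)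
  have hadd : Measurable (fun z : (Measure E × Measure E) × Measure E => z.2 + z.1.2) :=
    measurable_measure_add.comp (by fun_prop : Measurable fun z : (Measure E × Measure E) ×
      Measure E => (z.2, z.1.2))
  -- The thinning kernel with its arguments `(N, (Z, M))` reordered as `(Z, (N, M))`, so that it
  -- composes with the joint law of `N` and `M` given `Z`.
  let K : Kernel (S × (Measure E × Measure E)) (Measure E) := τ.comap _ hg
  have : IsMarkovKernel K := Kernel.IsMarkovKernel.comap τ hg
  have hV : HasCondDistrib N' ((fun z : Measure E × (S × Measure E) => (z.2.1, (z.1, z.2.2))) ∘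
      fun ω => (N ω, (Z ω, M ω))) K P := by
    refine HasCondDistrib.comp_right (hf := hf) ?_
    rw [← Kernel.comap_comp_right]
    exact hN'τ
  have htriple := hasCondDistrib_prodMk_compProd hjoint hV
  have hthin' : ∀ᵐ z ∂(P.map fun ω => (Z ω, (N ω, M ω))), ∃ (n : ℕ) (x : Fin n → E),
      z.2.1 = ∑ i, Measure.dirac (x i) ∧ K z = thinLaw p x := by
    refine ae_of_ae_map hg.aemeasurable (p := fun w => ∃ (n : ℕ) (x : Fin n → E),
      w.1 = ∑ i, Measure.dirac (x i) ∧ τ w = thinLaw p x) ?_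
    rw [Measure.map_map hg hZNM]
    exact hthin
  refine ⟨((κ ×ₖ η) ⊗ₖ K).map fun z => z.2 + z.1.2, Kernel.IsMarkovKernel.map _ hadd,
    htriple.comp_left hadd, ?_⟩
  filter_upwards [hNpoi, hMpoi, ae_ae_of_ae_hasCondDistrib hZ hjoint hthin'] with ω h1 h2 h3
  have := hΛ₁ ω
  have := hΛ₂ ω
  rw [Kernel.map_apply _ hadd, Kernel.compProd_apply_eq_compProd_sectR]
  rw [Kernel.prod_apply] at h3 ⊢
  exact isPoissonLaw_thinning_add h1 h2 hpm hp h3 (hΛ ω)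

end Superposition

/-! ### The retention function. -/

section Retention

variable {E : Type*} {f : E → ℝ}

lemma retention_of_one_le {s : E} (h : 1 ≤ f s) : retention f s = (f s)⁻¹ := by
  simp [retention, h, not_lt.2 h]

lemma retention_of_lt_one {s : E} (h : f s < 1) : retention f s = 1 := by
  simp [retention, h, not_le.2 h]

lemma measurable_retention [MeasurableSpace E] (hf : Measurable f) : Measurable (retention f) := by
  have h1 : MeasurableSet {t | 1 ≤ f t} := measurableSet_le measurable_const hf
  have h2 : MeasurableSet {t | f t < 1} := measurableSet_lt hf measurable_const
  exact (hf.inv.mul (measurable_const.indicator h1)).add (measurable_const.indicator h2)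

lemma retention_mem_Icc (f : E → ℝ) (s : E) : retention f s ∈ Set.Icc (0 : ℝ) 1 := by
  rcases le_or_gt 1 (f s) with h | h
  · rw [retention_of_one_le h]
    exact ⟨inv_nonneg.2 (zero_le_one.trans h), inv_le_one_of_one_le₀ h⟩
  · rw [retention_of_lt_one h]
    exact ⟨zero_le_one, le_rfl⟩

/-- For `f ≥ 1` the terms are `1` and `0`; for `f < 1` they are `f` and `1 - f`. -/
lemma retention_mul_add_max (f : E → ℝ) (s : E) : retention f s * f s + max (1 - f s) 0 = 1 := by
  rcases le_or_gt 1 (f s) with h | h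
  · rw [retention_of_one_le h, inv_mul_cancel₀ (zero_lt_one.trans_le h).ne',
      max_eq_right (by linarith), add_zero]
  · rw [retention_of_lt_one h, max_eq_left (by linarith)]
    ring

end Retention

/-! ### Intensities with respect to Lebesgue measure. -/

section Intensity

variable {d : ℕ}

lemma measurable_intensity {Ω : Type*} [MeasurableSpace Ω]
    {Φ : Ω → EuclideanSpace ℝ (Fin d) → ℝ} (hΦ : Measurable (Function.uncurry Φ)) :
    Measurable (fun ω => intensity (Φ ω)) := by
  refine Measure.measurable_of_measurable_coe _ fun B hB => ?_
  simp only [intensity, withDensity_apply _ hB]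
  exact hΦ.ennreal_ofReal.lintegral_prod_right' (ν := volume.restrict B)

lemma lintegral_intensity {g : EuclideanSpace ℝ (Fin d) → ℝ} (hg : Measurable g)
    {h : EuclideanSpace ℝ (Fin d) → ℝ≥0∞} (hh : Measurable h) :
    ∫⁻ s, h s ∂(intensity g) = ∫⁻ s, ENNReal.ofReal (g s) * h s := by
  rw [intensity, lintegral_withDensity_eq_lintegral_mul _ hg.ennreal_ofReal hh]
  rfl

/-- The thinned intensity and the complementary intensity add up to the full intensity. -/
lemma lintegral_retention_add {f ψ : EuclideanSpace ℝ (Fin d) → ℝ} (hf : Measurable f)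
    (hf0 : ∀ s, 0 ≤ f s) (hψ : Measurable ψ) (hψ0 : ∀ s, 0 ≤ ψ s)
    {h : EuclideanSpace ℝ (Fin d) → ℝ≥0∞} (hh : Measurable h) :
    ∫⁻ s, ENNReal.ofReal (retention f s) * h s ∂(intensity fun s => f s * ψ s) +
      ∫⁻ s, h s ∂(intensity fun s => max (1 - f s) 0 * ψ s) = ∫⁻ s, h s ∂(intensity ψ) := by
  have hp := measurable_retention hf
  rw [lintegral_intensity (by fun_prop) (by fun_prop), lintegral_intensity (by fun_prop) hh,
    lintegral_intensity hψ hh, ← lintegral_add_left (by fun_prop)]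
  refine lintegral_congr fun s => ?_
  rw [← mul_assoc, ← add_mul, ← ENNReal.ofReal_mul (mul_nonneg (hf0 s) (hψ0 s)),
    ← ENNReal.ofReal_add (mul_nonneg (mul_nonneg (hf0 s) (hψ0 s)) (retention_mem_Icc f s).1)
      (mul_nonneg (le_max_right _ _) (hψ0 s))]
  congr 2
  linear_combination ψ s * retention_mul_add_max f s

/-- Follows from `p f + (1 - f)_+ = 1` and `p ≤ 1`. It supplies the local integrability of `Ψ`,
which is known a priori only for the two partial intensities. -/
lemma intensity_apply_le {f ψ : EuclideanSpace ℝ (Fin d) → ℝ} (hf : Measurable f)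
    (hf0 : ∀ s, 0 ≤ f s) (hψ : Measurable ψ) (hψ0 : ∀ s, 0 ≤ ψ s)
    {B : Set (EuclideanSpace ℝ (Fin d))} (hB : MeasurableSet B) :
    intensity ψ B ≤ intensity (fun s => f s * ψ s) B +
      intensity (fun s => max (1 - f s) 0 * ψ s) B := by
  have hind : Measurable (B.indicator (1 : EuclideanSpace ℝ (Fin d) → ℝ≥0∞)) :=
    measurable_one.indicator hB
  simp_rw [← lintegral_indicator_one hB]
  rw [← lintegral_retention_add hf hf0 hψ hψ0 hind]
  gcongr with s
  exact mul_le_of_le_one_left zero_le (ENNReal.ofReal_le_one.2 (retention_mem_Icc f s).2)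

lemma intensity_max_restrict (f ψ : EuclideanSpace ℝ (Fin d) → ℝ) (hf : Measurable f) :
    (intensity fun s => max (1 - f s) 0 * ψ s).restrict {s | f s < 1} =
      (intensity fun s => (1 - f s) * ψ s).restrict {s | f s < 1} := by
  have hB : MeasurableSet {s | f s < 1} := measurableSet_lt hf measurable_const
  rw [intensity, intensity, restrict_withDensity hB, restrict_withDensity hB]
  refine withDensity_congr_ae ?_
  filter_upwards [ae_restrict_mem hB] with s hs
  rw [max_eq_left (sub_nonneg.2 (le_of_lt hs))]

lemma intensity_max_apply_eq_zero (f ψ : EuclideanSpace ℝ (Fin d) → ℝ) (hf : Measurable f) :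
    (intensity fun s => max (1 - f s) 0 * ψ s) {s | 1 ≤ f s} = 0 := by
  have hB : MeasurableSet {s | 1 ≤ f s} := measurableSet_le measurable_const hf
  rw [intensity, withDensity_apply _ hB, setLIntegral_congr_fun hB (g := fun _ => 0)]
  · simp
  · intro s hs
    simp [max_eq_right (sub_nonpos.2 (show 1 ≤ f s from hs))]

end Intensity

end CoxThinning

end

/-! ### The main theorem. -/

theorem mainTheorem7 {d : ℕ} (hd : 0 < d) {Ω : Type*} [MeasurableSpace Ω]
    (P : Measure Ω) [IsProbabilityMeasure P]
    (Ψ : Ω → EuclideanSpace ℝ (Fin d) → ℝ) (hΨ : Measurable (Function.uncurry Ψ))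
    (hΨ_nonneg : ∀ ω s, 0 ≤ Ψ ω s)
    (f : EuclideanSpace ℝ (Fin d) → ℝ) (hf : Measurable f) (hf_nonneg : ∀ s, 0 ≤ f s)
    (Λ : Ω → Measure (EuclideanSpace ℝ (Fin d)))
    (hΛ : Λ = fun ω => CoxThinning.intensity (Ψ ω))
    (N N' M : Ω → Measure (EuclideanSpace ℝ (Fin d)))
    (hN : CoxThinning.IsCoxProcessGiven P Λ
      (fun ω => CoxThinning.intensity (fun s => f s * Ψ ω s)) N)
    (hN_finite : ∀ᵐ ω ∂P, N ω Set.univ < ∞)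
    (hM : CoxThinning.IsCoxProcessGiven P Λ
      (fun ω => CoxThinning.intensity (fun s => max (1 - f s) 0 * Ψ ω s)) M)
    (hNM : CoxThinning.CondIndepGiven P Λ N M)
    (hN' : CoxThinning.IsThinningGiven P (fun ω => (Λ ω, M ω)) (CoxThinning.retention f) N N') :
    Measurable (CoxThinning.retention f) ∧
    (∀ s, CoxThinning.retention f s ∈ Set.Icc (0 : ℝ) 1) ∧
    (∀ᵐ ω ∂P, N' ω + M ω = (N' ω).restrict {s | 1 ≤ f s} + (N ω).restrict {s | f s < 1} +
      (M ω).restrict {s | f s < 1}) ∧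
    CoxThinning.IsThinningGiven P (fun ω => (N ω, (Λ ω, M ω))) (CoxThinning.retention f)
      (fun ω => (N ω).restrict {s | 1 ≤ f s}) (fun ω => (N' ω).restrict {s | 1 ≤ f s}) ∧
    CoxThinning.IsCoxProcessGiven P Λ
      (fun ω => (CoxThinning.intensity (fun s => (1 - f s) * Ψ ω s)).restrict {s | f s < 1})
      (fun ω => (M ω).restrict {s | f s < 1}) ∧
    CoxThinning.IsCoxProcess P Λ (fun ω => N' ω + M ω) := by
  have hA : MeasurableSet {s | 1 ≤ f s} := measurableSet_le measurable_const hf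
  have hB : MeasurableSet {s | f s < 1} := measurableSet_lt hf measurable_const
  have hcompl : {s | 1 ≤ f s}ᶜ = {s | f s < 1} := by ext; simp
  have hΛm : Measurable Λ := hΛ ▸ CoxThinning.measurable_intensity hΨ
  have hΨω : ∀ ω, Measurable (Ψ ω) := fun ω => hΨ.comp measurable_prodMk_left
  have hNm := hN.pointProcess.measurable
  have hMm := hM.pointProcess.measurable
  have hp := CoxThinning.retention_mem_Icc f
  have hpm := CoxThinning.measurable_retention hf
  have hkeep := hN'.ae_restrict_eq (hΛm.prodMk hMm) hNm hN_finite hp hB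
    fun s hs => CoxThinning.retention_of_lt_one hs
  have hM0 := hM.ae_apply_eq_zero hΛm hA
    (Filter.Eventually.of_forall fun ω => CoxThinning.intensity_max_apply_eq_zero f (Ψ ω) hf)
  have hsplit : ∀ᵐ ω ∂P, N' ω + M ω = (N' ω).restrict {s | 1 ≤ f s} +
      (N ω).restrict {s | f s < 1} + (M ω).restrict {s | f s < 1} := by
    filter_upwards [hkeep, hM0] with ω h1 h2
    conv_lhs => rw [← Measure.restrict_add_restrict_compl (μ := N' ω) hA,
      ← Measure.restrict_add_restrict_compl (μ := M ω) hA, hcompl, h1,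
      Measure.restrict_eq_zero.2 h2, zero_add]
  refine ⟨hpm, hp, hsplit, hN'.restrict (hΛm.prodMk hMm) hNm hN_finite hp hA, ?_, ?_, ?_, ?_⟩
  · simpa only [CoxThinning.intensity_max_restrict f _ hf] using hM.restrict hB
  · refine ⟨hΛm, ?_⟩
    filter_upwards [hN.directing.boundedlyFinite, hM.directing.boundedlyFinite] with ω h1 h2 C hC hCb
    rw [hΛ]
    exact (CoxThinning.intensity_apply_le hf hf_nonneg (hΨω ω) (hΨ_nonneg ω) hC).trans_lt
      (ENNReal.add_lt_top.2 ⟨h1 C hC hCb, h2 C hC hCb⟩)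
  · refine ⟨CoxThinning.measurable_measure_add.comp
      (hN'.pointProcess.measurable.prodMk hMm), ?_⟩
    -- Positive dimension makes Lebesgue measure diffuse; in dimension zero it has an atom.
    have : Nonempty (Fin d) := ⟨⟨0, hd⟩⟩
    have hcommon := hNM.ae_no_common_point hΛm hN hM fun ω =>
      nullSingletonClass_withDensity _
    filter_upwards [hkeep, hM0, hcommon, hM.pointProcess.simpleCounting,
      hN'.pointProcess.simpleCounting] with ω h1 h2 h3 h5 h6
    refine ⟨fun C hC hCb => ?_, fun x => ?_⟩
    · obtain ⟨m, hm⟩ := h6.natural C hC hCb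
      obtain ⟨n, hn⟩ := h5.natural C hC hCb
      exact ⟨m + n, by rw [Measure.add_apply, hm, hn, Nat.cast_add]⟩
    · rw [Measure.add_apply]
      -- Where `f ≥ 1`, `M` has no point at `x`. Where `f < 1`, the thinning agrees with `N`, which
      -- has no point in common with `M`.
      rcases le_or_gt 1 (f x) with hx | hx
      · rw [measure_mono_null (Set.singleton_subset_iff.2 (show x ∈ {s | 1 ≤ f s} from hx)) h2,
          add_zero]
        exact h6.simple x
      · have hNx : N' ω {x} = N ω {x} := by
          have := congrArg (fun φ => φ {x}) h1
          beta_reduce at this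
          have hxs : {x} ⊆ {s | f s < 1} := Set.singleton_subset_iff.2 hx
          rwa [Measure.restrict_eq_self _ hxs, Measure.restrict_eq_self _ hxs] at this
        rcases h3 x with h0 | h0
        · rw [hNx, h0, zero_add]
          exact h5.simple x
        · rw [h0, add_zero]
          exact h6.simple x
  · refine CoxThinning.exists_poisson_kernel_thinning_add hΛm hN hM hNM hN'
      (fun ω => SigmaFinite.withDensity_ofReal _) (fun ω => SigmaFinite.withDensity_ofReal _)
      hpm hp fun ω h hh => ?_
    rw [hΛ]
    exact CoxThinning.lintegral_retention_add hf hf_nonneg (hΨω ω) (hΨ_nonneg ω) hh
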